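/- Let $A\to M$ be a Lie algebroid over a smooth manifold, with anchor $\rho$, and let $I=[0,1]$. An $A$-path from $x$ to $y$ is a (smooth) Lie algebroid morphism $a\,dt:TI\to A$ whose base path goes from $x$ to $y$. An $A$-homotopy $\sigma:a_0\Rightarrow a_1$ between two $A$-paths from $x$ to $y$ is a Lie algebroid morphism $\sigma=a\,dt+b\,ds:TI^2\to A$ with $a\,dt|_{s=0}=a_0\,dt$, $a\,dt|_{s=1}=a_1\,dt$ and $b|_{t=0,1}=0$; it is thin if $\wedge^2\sigma=0$, i.e. $a\wedge b=0$ everywhere. A $3$-homotopy between $A$-homotopies $\sigma_0,\sigma_1$ is a Lie algebroid morphism $H=H_1dt+H_2ds+H_3du:TI^3\to A$ with $H_3=0$ for $t=0,1$ and for $s=0,1$, and with $(H_1dt+H_2ds)|_{u=0}=\sigma_0$, $(H_1dt+H_2ds)|_{u=1}=\sigma_1$. Then thin homotopy, $A$-homotopy and $3$-homotopy are equivalence relations. Let $P_1(A)$ be the set of thin homotopy classes of $A$-paths (the $1$-morphisms of the Weinstein $2$-groupoid of $A$), $P_2(A)$ the set of $3$-homotopy classes of $A$-homotopies (its $2$-morphisms),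 with source and target maps $P_2(A)\rightrightarrows P_1(A)$ induced by $(\sigma:a_0\Rightarrow a_1)\mapsto a_0,a_1$, and $\mathcal G(A)$ the set of $A$-homotopy classes of $A$-paths. Both $P_1(A)$ and $\mathcal G(A)$ (the Weinstein groupoid of $A$) are groupoids over $M$: units are the classes of the zero paths $0_x\,dt$, inverses are given by $a(t)\,dt\mapsto -a(1-t)\,dt$, and the product $[b]\cdot[a]$ is the class of the concatenation of $a$ and $b$, if it is smooth, and in general of the concatenation of their reparametrizations $\tau'(t)\,a(\tau(t))\,dt$ and $\tau'(t)\,b(\tau(t))\,dt$, where $\tau:\mathbb R\to[0,1]$ is any smooth function with $\tau=0$ on $(-\infty,0]$ and $\tau=1$ on $[1,\infty)$. Call two elements of $P_1(A)$ related if there is an element of $P_2(A)$ from one to the other. This is an equivalence relation, the groupoid structure of $P_1(A)$ descends to the orbit space $P_1(A)/P_2(A)$ (the $1$-truncation of the Weinstein $2$-groupoid), and $[[a]]\mapsto[a]$ is a well-defined isomorphism of groupoids over $M$ (the identity on objects) $$P_1(A)/P_2(A)\;\cong\;\mathcal G(A).$$ -/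

import Mathlib

open Bundle Set
open scoped Manifold ContDiff

noncomputable section

namespace Weinstein

universe uE uM uF uA

section Algebroid

variable {E : Type uE} [NormedAddCommGroup E] [NormedSpace ℝ E]
  {M : Type uM} [TopologicalSpace M] [ChartedSpace E M]

/-- The derivative `v(f)` of a real function `f` at `x` along a tangent vector `v`. -/
def dirDeriv (f : M → ℝ) (x : M) (v : TangentSpace 𝓘(ℝ, E) x) : ℝ :=
  mfderiv 𝓘(ℝ, E) 𝓘(ℝ, ℝ) f x v

variable {F : Type uF} [NormedAddCommGroup F] [NormedSpace ℝ F]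
  {A : M → Type uA} [TopologicalSpace (TotalSpace F A)]
  [∀ x, AddCommGroup (A x)] [∀ x, Module ℝ (A x)] [∀ x, TopologicalSpace (A x)]
  [FiberBundle F A] [VectorBundle ℝ F A]

/-- The product `f X` of a smooth function and a smooth section. -/
def funSmul (f : C^∞⟮𝓘(ℝ, E), M; 𝓘(ℝ, ℝ), ℝ⟯) (X : Cₛ^∞⟮𝓘(ℝ, E); F, A⟯) :
    Cₛ^∞⟮𝓘(ℝ, E); F, A⟯ :=
  ⟨fun x => f x • X x, f.contMDiff.smul_section X.contMDiff⟩

variable (E M F A) in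
/-- A Lie algebroid structure on the smooth vector bundle `A → M`: an anchor `ρ : A → TM`
(a smooth section of `Hom(A, TM)`) and a Lie bracket on the space of smooth sections of `A`
which satisfies the Leibniz rule `[X, f Y] = f [X, Y] + (ρ(X) f) Y`. -/
structure LieAlgebroid [IsManifold 𝓘(ℝ, E) ∞ M] where
  anchor : Cₛ^∞⟮𝓘(ℝ, E); F →L[ℝ] E, fun x : M => A x →L[ℝ] TangentSpace 𝓘(ℝ, E) x⟯
  bracket : Cₛ^∞⟮𝓘(ℝ, E); F, A⟯ →ₗ[ℝ] Cₛ^∞⟮𝓘(ℝ, E); F, A⟯ →ₗ[ℝ] Cₛ^∞⟮𝓘(ℝ, E); F, A⟯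
  bracket_self : ∀ X, bracket X X = 0
  jacobi : ∀ X Y Z,
    bracket X (bracket Y Z) + bracket Y (bracket Z X) + bracket Z (bracket X Y) = 0
  leibniz : ∀ (X Y : Cₛ^∞⟮𝓘(ℝ, E); F, A⟯) (f : C^∞⟮𝓘(ℝ, E), M; 𝓘(ℝ, ℝ), ℝ⟯) (x : M),
    bracket X (funSmul f Y) x
      = f x • bracket X Y x + dirDeriv f x (anchor x (X x)) • Y x

variable (E M F A) in
/-- Smooth sections of the dual bundle `A^*`. -/
abbrev DualSection :=
  Cₛ^∞⟮𝓘(ℝ, E); F →L[ℝ] ℝ, fun x : M => A x →L[ℝ] Bundle.Trivial M ℝ x⟯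

/-- The pairing of a section of `A^*` with a vector of `A`. -/
def DualSection.pair (θ : DualSection E M F A) (x : M) (v : A x) : ℝ := θ x v

variable [IsManifold 𝓘(ℝ, E) ∞ M]

/-- The Lie algebroid differential of a 1-form,
`(d_A θ)(X, Y) = ρ(X) θ(Y) - ρ(Y) θ(X) - θ([X, Y])`, at the point `x`. -/
def LieAlgebroid.d (L : LieAlgebroid E M F A) (θ : DualSection E M F A)
    (X Y : Cₛ^∞⟮𝓘(ℝ, E); F, A⟯) (x : M) : ℝ :=
  dirDeriv (fun y => θ.pair y (Y y)) x (L.anchor x (X x))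
    - dirDeriv (fun y => θ.pair y (X y)) x (L.anchor x (Y x))
    - θ.pair x (L.bracket X Y x)

/-- The unit cube `I^n`. -/
def cube (n : ℕ) : Set (Fin n → ℝ) := Icc 0 1

/-- A Lie algebroid morphism `∑ i, a i dt_i : T I^n → A`. It consists of a base map `I^n → M` and
of sections `a i` of `A` along it, smooth up to the boundary of the cube, which are compatible with
the anchors, `ρ (a i) = ∂_i (base)`, and with the differentials,
`∂_i ⟨θ, a j⟩ - ∂_j ⟨θ, a i⟩ = (d_A θ)(a i, a j)` for all 1-forms `θ`, where the right hand side is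
computed with arbitrary sections through the two vectors. (Functions are defined on `ℝ^n` but only
their values on the cube matter.) -/
structure CubeMorphism (L : LieAlgebroid E M F A) (n : ℕ) where
  base : (Fin n → ℝ) → M
  comp : Fin n → ∀ p, A (base p)
  smooth : ∀ i, ContMDiffOn 𝓘(ℝ, Fin n → ℝ) (𝓘(ℝ, E).prod 𝓘(ℝ, F)) ∞
    (fun p => (⟨base p, comp i p⟩ : TotalSpace F A)) (cube n)
  anchor_eq : ∀ i, ∀ p ∈ cube n,
    L.anchor (base p) (comp i p)
      = mfderivWithin 𝓘(ℝ, Fin n → ℝ) 𝓘(ℝ, E) base (cube n) p (Pi.single i (1 : ℝ) : Fin n → ℝ)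
  d_eq : ∀ i j, i < j → ∀ p ∈ cube n, ∀ (θ : DualSection E M F A)
    (X Y : Cₛ^∞⟮𝓘(ℝ, E); F, A⟯), X (base p) = comp i p → Y (base p) = comp j p →
    fderivWithin ℝ (fun q => θ.pair (base q) (comp j q)) (cube n) p (Pi.single i 1)
      - fderivWithin ℝ (fun q => θ.pair (base q) (comp i q)) (cube n) p (Pi.single j 1)
      = L.d θ X Y (base p)

/-- The `i`-th component at `p`, as a point of the total space of `A`. -/
def CubeMorphism.val {L : LieAlgebroid E M F A} {n : ℕ} (σ : CubeMorphism L n) (i : Fin n)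
    (p : Fin n → ℝ) : TotalSpace F A := ⟨σ.base p, σ.comp i p⟩

/-- `A`-paths `a dt : T I → A` from `x` to `y`. -/
structure APath (L : LieAlgebroid E M F A) (x y : M) extends CubeMorphism L 1 where
  base_zero : base ![0] = x
  base_one : base ![1] = y

/-- The point `a(t)` of `A`. -/
def APath.at {L : LieAlgebroid E M F A} {x y : M} (a : APath L x y) (t : ℝ) : TotalSpace F A :=
  a.val 0 ![t]

/-- `A`-homotopies `a dt + b ds : T I^2 → A` between two `A`-paths, in the coordinates `![t, s]`. -/
structure AHomotopy {L : LieAlgebroid E M F A} {x y : M} (a₀ a₁ : APath L x y) extends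
    CubeMorphism L 2 where
  source_eq : ∀ t ∈ Icc (0 : ℝ) 1, toCubeMorphism.val 0 ![t, 0] = a₀.at t
  target_eq : ∀ t ∈ Icc (0 : ℝ) 1, toCubeMorphism.val 0 ![t, 1] = a₁.at t
  b_zero : ∀ s ∈ Icc (0 : ℝ) 1, comp 1 ![0, s] = 0
  b_one : ∀ s ∈ Icc (0 : ℝ) 1, comp 1 ![1, s] = 0

/-- An `A`-homotopy `a dt + b ds` is thin if `a ∧ b = 0` everywhere. -/
def AHomotopy.IsThin {L : LieAlgebroid E M F A} {x y : M} {a₀ a₁ : APath L x y}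
    (σ : AHomotopy a₀ a₁) : Prop :=
  ∀ p ∈ cube 2, ExteriorAlgebra.ι ℝ (σ.comp 0 p) * ExteriorAlgebra.ι ℝ (σ.comp 1 p) = 0

/-- Two `A`-paths are `A`-homotopic. -/
def AHomotopic (L : LieAlgebroid E M F A) {x y : M} (a₀ a₁ : APath L x y) : Prop :=
  Nonempty (AHomotopy a₀ a₁)

/-- Two `A`-paths are thin homotopic. -/
def ThinHomotopic (L : LieAlgebroid E M F A) {x y : M} (a₀ a₁ : APath L x y) : Prop :=
  ∃ σ : AHomotopy a₀ a₁, σ.IsThin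

/-- All `A`-homotopies between `A`-paths from `x` to `y`. -/
structure TotalAHomotopy (L : LieAlgebroid E M F A) (x y : M) where
  src : APath L x y
  tgt : APath L x y
  hom : AHomotopy src tgt

/-- Two `A`-homotopies `σ₀`, `σ₁` are 3-homotopic: there is a Lie algebroid morphism
`H₁ dt + H₂ ds + H₃ du : T I^3 → A`, in the coordinates `![t, s, u]`, with `H₃ = 0` for `t = 0, 1`
and for `s = 0, 1`, which restricts to `σ₀` at `u = 0` and to `σ₁` at `u = 1`. -/
def ThreeHomotopic (L : LieAlgebroid E M F A) {x y : M} (σ₀ σ₁ : TotalAHomotopy L x y) : Prop :=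
  ∃ H : CubeMorphism L 3,
    (∀ s ∈ Icc (0 : ℝ) 1, ∀ u ∈ Icc (0 : ℝ) 1, H.comp 2 ![0, s, u] = 0 ∧ H.comp 2 ![1, s, u] = 0) ∧
    (∀ t ∈ Icc (0 : ℝ) 1, ∀ u ∈ Icc (0 : ℝ) 1, H.comp 2 ![t, 0, u] = 0 ∧ H.comp 2 ![t, 1, u] = 0) ∧
    (∀ t ∈ Icc (0 : ℝ) 1, ∀ s ∈ Icc (0 : ℝ) 1,
      H.val 0 ![t, s, 0] = σ₀.hom.val 0 ![t, s] ∧ H.val 1 ![t, s, 0] = σ₀.hom.val 1 ![t, s]) ∧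
    (∀ t ∈ Icc (0 : ℝ) 1, ∀ s ∈ Icc (0 : ℝ) 1,
      H.val 0 ![t, s, 1] = σ₁.hom.val 0 ![t, s] ∧ H.val 1 ![t, s, 1] = σ₁.hom.val 1 ![t, s])

/-- The 1-morphisms `x → y` of the Weinstein 2-groupoid: thin homotopy classes of `A`-paths. -/
def P₁ (L : LieAlgebroid E M F A) (x y : M) := Quot (ThinHomotopic L (x := x) (y := y))

/-- The 2-morphisms of the Weinstein 2-groupoid with horizontal source `x` and horizontal
target `y`: 3-homotopy classes of `A`-homotopies. -/
def P₂ (L : LieAlgebroid E M F A) (x y : M) := Quot (ThreeHomotopic L (x := x) (y := y))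

/-- The arrows `x → y` of the Weinstein groupoid `G(A)`: `A`-homotopy classes of `A`-paths. -/
def G (L : LieAlgebroid E M F A) (x y : M) := Quot (AHomotopic L (x := x) (y := y))

/-- The thin homotopy class of an `A`-path. -/
def P₁.mk {L : LieAlgebroid E M F A} {x y : M} (a : APath L x y) : P₁ L x y := Quot.mk _ a

/-- The homotopy class of an `A`-path. -/
def G.mk {L : LieAlgebroid E M F A} {x y : M} (a : APath L x y) : G L x y := Quot.mk _ a

/-! The vertical source and target of a 3-homotopy class are well defined: a 3-homotopy restricts
on the faces `s = 0` and `s = 1` to thin homotopies. -/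

lemma uniqueDiffOn_cube (n : ℕ) : UniqueDiffOn ℝ (cube n) := by
  refine uniqueDiffOn_convex (convex_Icc _ _) ⟨fun _ => 1 / 2, ?_⟩
  have : (Set.univ.pi fun _ : Fin n => Ioo (0 : ℝ) 1) ⊆ cube n := fun p hp =>
    ⟨fun i => (hp i trivial).1.le, fun i => (hp i trivial).2.le⟩
  refine interior_maximal this (isOpen_set_pi finite_univ fun _ _ => isOpen_Ioo) ?_
  intro i _
  norm_num

/-- The inclusion of the face `s = c` of the cube with coordinates `![t, s, u]`. -/
def face (c : ℝ) (p : Fin 2 → ℝ) : Fin 3 → ℝ := ![p 0, c, p 1]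

/-- The linear part of `face c`. -/
def faceLin : (Fin 2 → ℝ) →L[ℝ] (Fin 3 → ℝ) :=
  ContinuousLinearMap.pi
    ![ContinuousLinearMap.proj 0, 0, ContinuousLinearMap.proj 1]

lemma hasFDerivAt_face (c : ℝ) (p : Fin 2 → ℝ) : HasFDerivAt (face c) faceLin p := by
  rw [hasFDerivAt_pi']
  intro i
  fin_cases i
  · exact hasFDerivAt_apply (𝕜 := ℝ) (0 : Fin 2) p
  · exact hasFDerivAt_const c p
  · exact hasFDerivAt_apply (𝕜 := ℝ) (1 : Fin 2) p

lemma contDiff_face (c : ℝ) : ContDiff ℝ ∞ (face c) := by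
  rw [contDiff_pi]
  intro i
  fin_cases i
  · exact contDiff_apply ℝ ℝ (0 : Fin 2)
  · exact contDiff_const
  · exact contDiff_apply ℝ ℝ (1 : Fin 2)

lemma mapsTo_face {c : ℝ} (hc : c ∈ Icc (0 : ℝ) 1) : MapsTo (face c) (cube 2) (cube 3) := by
  intro p hp
  refine ⟨fun i => ?_, fun i => ?_⟩
  · fin_cases i
    exacts [hp.1 0, hc.1, hp.1 1]
  · fin_cases i
    exacts [hp.2 0, hc.2, hp.2 1]

/-- The index of the coordinate of the cube which restricts to the given one of the face. -/
def faceIdx : Fin 2 → Fin 3 := ![0, 2]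

lemma faceLin_single (i : Fin 2) : faceLin (Pi.single i 1) = Pi.single (faceIdx i) 1 := by
  funext k
  fin_cases i <;> fin_cases k <;> simp [faceLin, faceIdx]

lemma CubeMorphism.contMDiffOn_base {L : LieAlgebroid E M F A} {n : ℕ} (σ : CubeMorphism L n)
    (i : Fin n) : ContMDiffOn 𝓘(ℝ, Fin n → ℝ) 𝓘(ℝ, E) ∞ σ.base (cube n) := by
  intro p hp
  exact ((contMDiffWithinAt_totalSpace).1 (σ.smooth i p hp)).1

lemma CubeMorphism.differentiableOn_pair [ContMDiffVectorBundle ∞ F A 𝓘(ℝ, E)]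
    {L : LieAlgebroid E M F A} {n : ℕ}
    (σ : CubeMorphism L n) (θ : DualSection E M F A) (i : Fin n) :
    DifferentiableOn ℝ (fun q => θ.pair (σ.base q) (σ.comp i q)) (cube n) := by
  intro p hp
  have h1 := σ.contMDiffOn_base i p hp
  have h2 := θ.contMDiff.contMDiffAt.comp_contMDiffWithinAt p h1
  have h3 := ContMDiffWithinAt.clm_bundle_apply (E₂ := Bundle.Trivial M ℝ) (F₂ := ℝ)
    h2 (σ.smooth i p hp)
  have h4 := ((contMDiffWithinAt_totalSpace).1 h3).2
  exact (h4.contDiffWithinAt).differentiableWithinAt (by simp)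

/-- The restriction of `H₁ dt + H₂ ds + H₃ du` to the face `s = c`. -/
def CubeMorphism.restrict [ContMDiffVectorBundle ∞ F A 𝓘(ℝ, E)]
    {L : LieAlgebroid E M F A} (H : CubeMorphism L 3) {c : ℝ}
    (hc : c ∈ Icc (0 : ℝ) 1) : CubeMorphism L 2 where
  base p := H.base (face c p)
  comp i p := H.comp (faceIdx i) (face c p)
  smooth i := (H.smooth (faceIdx i)).comp (contDiff_face c).contMDiff.contMDiffOn (mapsTo_face hc)
  anchor_eq i p hp := by
    rw [H.anchor_eq (faceIdx i) _ (mapsTo_face hc hp), ← faceLin_single]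
    have h1 : HasMFDerivWithinAt 𝓘(ℝ, Fin 2 → ℝ) 𝓘(ℝ, Fin 3 → ℝ) (face c) (cube 2) p faceLin :=
      (hasFDerivAt_face c p).hasFDerivWithinAt.hasMFDerivWithinAt
    have h2 := (((H.contMDiffOn_base 0) _ (mapsTo_face hc hp)).mdifferentiableWithinAt
      (by simp)).hasMFDerivWithinAt
    have h3 := (h2.comp p h1 (mapsTo_face hc)).mfderivWithin
      ((uniqueDiffOn_cube 2).uniqueMDiffOn p hp)
    change _ = mfderivWithin _ _ (H.base ∘ face c) _ _ _
    rw [h3]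
    rfl
  d_eq i j hij p hp θ X Y hX hY := by
    have key : ∀ k : Fin 3, ∀ i : Fin 2,
        fderivWithin ℝ (fun q => θ.pair (H.base (face c q)) (H.comp k (face c q))) (cube 2) p
          (Pi.single i 1)
        = fderivWithin ℝ (fun q => θ.pair (H.base q) (H.comp k q)) (cube 3) (face c p)
          (Pi.single (faceIdx i) 1) := by
      intro k i
      have h1 := (hasFDerivAt_face c p).hasFDerivWithinAt (s := cube 2)
      have h2 := (H.differentiableOn_pair θ k _ (mapsTo_face hc hp)).hasFDerivWithinAt
      have h3 := (h2.comp p h1 (mapsTo_face hc)).fderivWithin (uniqueDiffOn_cube 2 p hp)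
      rw [← faceLin_single]
      exact congrArg (fun T => T (Pi.single i 1)) h3
    rw [key, key]
    refine H.d_eq (faceIdx i) (faceIdx j) ?_ _ (mapsTo_face hc hp) θ X Y hX hY
    fin_cases i <;> fin_cases j <;> simp_all [faceIdx]

lemma ThreeHomotopic.thin_src [ContMDiffVectorBundle ∞ F A 𝓘(ℝ, E)]
    {L : LieAlgebroid E M F A} {x y : M} {σ₀ σ₁ : TotalAHomotopy L x y}
    (h : ThreeHomotopic L σ₀ σ₁) : ThinHomotopic L σ₀.src σ₁.src := by
  obtain ⟨H, ht, hs, h0, h1⟩ := h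
  have z : (0 : ℝ) ∈ Icc (0 : ℝ) 1 := by simp
  refine ⟨⟨H.restrict z, fun t h => ?_, fun t h => ?_, fun s h => ?_, fun s h => ?_⟩, fun p hp => ?_⟩
  · exact (h0 t h 0 z).1.trans (σ₀.hom.source_eq t h)
  · exact (h1 t h 0 z).1.trans (σ₁.hom.source_eq t h)
  · exact (ht 0 z s h).1
  · exact (ht 0 z s h).2
  · have : (H.restrict z).comp 1 p = 0 := (hs (p 0) ⟨hp.1 0, hp.2 0⟩ (p 1) ⟨hp.1 1, hp.2 1⟩).1
    change _ * ExteriorAlgebra.ι ℝ ((H.restrict z).comp 1 p) = 0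
    rw [this, map_zero, mul_zero]

lemma ThreeHomotopic.thin_tgt [ContMDiffVectorBundle ∞ F A 𝓘(ℝ, E)]
    {L : LieAlgebroid E M F A} {x y : M} {σ₀ σ₁ : TotalAHomotopy L x y}
    (h : ThreeHomotopic L σ₀ σ₁) : ThinHomotopic L σ₀.tgt σ₁.tgt := by
  obtain ⟨H, ht, hs, h0, h1⟩ := h
  have z : (1 : ℝ) ∈ Icc (0 : ℝ) 1 := by simp
  refine ⟨⟨H.restrict z, fun t h => ?_, fun t h => ?_, fun s h => ?_, fun s h => ?_⟩, fun p hp => ?_⟩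
  · exact (h0 t h 1 z).1.trans (σ₀.hom.target_eq t h)
  · exact (h1 t h 1 z).1.trans (σ₁.hom.target_eq t h)
  · exact (ht 1 z s h).1
  · exact (ht 1 z s h).2
  · have : (H.restrict z).comp 1 p = 0 := (hs (p 0) ⟨hp.1 0, hp.2 0⟩ (p 1) ⟨hp.1 1, hp.2 1⟩).2
    change _ * ExteriorAlgebra.ι ℝ ((H.restrict z).comp 1 p) = 0
    rw [this, map_zero, mul_zero]

/-- The vertical source `P₂ → P₁`. -/
def P₂.src [ContMDiffVectorBundle ∞ F A 𝓘(ℝ, E)] {L : LieAlgebroid E M F A} {x y : M} :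
    P₂ L x y → P₁ L x y :=
  Quot.lift (fun σ => P₁.mk σ.src) fun _ _ h => Quot.sound h.thin_src

/-- The vertical target `P₂ → P₁`. -/
def P₂.tgt [ContMDiffVectorBundle ∞ F A 𝓘(ℝ, E)] {L : LieAlgebroid E M F A} {x y : M} :
    P₂ L x y → P₁ L x y :=
  Quot.lift (fun σ => P₁.mk σ.tgt) fun _ _ h => Quot.sound h.thin_tgt

/-- Two 1-morphisms are identified in the 1-truncation if there is a 2-morphism between them. -/
def P₂.Related [ContMDiffVectorBundle ∞ F A 𝓘(ℝ, E)] (L : LieAlgebroid E M F A) {x y : M}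
    (α β : P₁ L x y) : Prop :=
  ∃ p : P₂ L x y, p.src = α ∧ p.tgt = β

/-- The arrows `x → y` of the 1-truncation `P₁(A) / P₂(A)` of the Weinstein 2-groupoid. -/
def Truncation [ContMDiffVectorBundle ∞ F A 𝓘(ℝ, E)] (L : LieAlgebroid E M F A) (x y : M) :=
  Quot (P₂.Related L (x := x) (y := y))

/-- The orbit of a 1-morphism. -/
def Truncation.mk [ContMDiffVectorBundle ∞ F A 𝓘(ℝ, E)] {L : LieAlgebroid E M F A} {x y : M}
    (α : P₁ L x y) : Truncation L x y := Quot.mk _ α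

end Algebroid

section Groupoids

/-- A groupoid structure on a family of sets of arrows `Hom x y` from `x` to `y`;
`comp g f` is "`f`, then `g`". -/
structure GroupoidOver {M : Type*} (Hom : M → M → Type*) where
  one : ∀ x, Hom x x
  comp : ∀ {x y z}, Hom y z → Hom x y → Hom x z
  inv : ∀ {x y}, Hom x y → Hom y x
  assoc : ∀ {w x y z} (h : Hom y z) (g : Hom x y) (f : Hom w x),
    comp (comp h g) f = comp h (comp g f)
  one_comp : ∀ {x y} (f : Hom x y), comp (one y) f = f
  comp_one : ∀ {x y} (f : Hom x y), comp f (one x) = f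
  inv_comp : ∀ {x y} (f : Hom x y), comp (inv f) f = one x
  comp_inv : ∀ {x y} (f : Hom x y), comp f (inv f) = one y

/-- Morphisms of groupoids over `M` which are the identity on objects. -/
structure GroupoidOver.IsMorphism {M : Type*} {Hom Hom' : M → M → Type*} (S : GroupoidOver Hom)
    (T : GroupoidOver Hom') (φ : ∀ x y, Hom x y → Hom' x y) : Prop where
  map_one : ∀ x, φ x x (S.one x) = T.one x
  map_comp : ∀ {x y z} (g : Hom y z) (f : Hom x y),
    φ x z (S.comp g f) = T.comp (φ y z g) (φ x y f)
  map_inv : ∀ {x y} (f : Hom x y), φ y x (S.inv f) = T.inv (φ x y f)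

end Groupoids

section Concatenation

/-- Cut-off functions. -/
structure IsCutoff (τ : ℝ → ℝ) : Prop where
  smooth : ContDiff ℝ ∞ τ
  mem_Icc : ∀ t, τ t ∈ Icc (0 : ℝ) 1
  eq_zero : ∀ t ≤ 0, τ t = 0
  eq_one : ∀ t, 1 ≤ t → τ t = 1

variable {E : Type uE} [NormedAddCommGroup E] [NormedSpace ℝ E]
  {M : Type uM} [TopologicalSpace M] [ChartedSpace E M] [IsManifold 𝓘(ℝ, E) ∞ M]
  {F : Type uF} [NormedAddCommGroup F] [NormedSpace ℝ F]
  {A : M → Type uA} [TopologicalSpace (TotalSpace F A)]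
  [∀ x, AddCommGroup (A x)] [∀ x, Module ℝ (A x)] [∀ x, TopologicalSpace (A x)]
  [FiberBundle F A] [VectorBundle ℝ F A] {L : LieAlgebroid E M F A}

/-- Scalar multiplication in the fibres of `A`. -/
def scale (r : ℝ) (v : TotalSpace F A) : TotalSpace F A := ⟨v.1, r • v.2⟩

/-- `e` is the unit path `0_x dt` at `x`. -/
def IsUnitPath {x : M} (e : APath L x x) : Prop :=
  ∀ t ∈ Icc (0 : ℝ) 1, e.at t = ⟨x, 0⟩

/-- `b` is the inverse path `-a(1 - t) dt` of `a`. -/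
def IsInverse {x y : M} (a : APath L x y) (b : APath L y x) : Prop :=
  ∀ t ∈ Icc (0 : ℝ) 1, b.at t = scale (-1) (a.at (1 - t))

/-- `a'` is the reparametrization `τ'(t) a(τ(t)) dt` of `a`. -/
def IsReparam (τ : ℝ → ℝ) {x y : M} (a a' : APath L x y) : Prop :=
  ∀ t ∈ Icc (0 : ℝ) 1, a'.at t = scale (deriv τ t) (a.at (τ t))

/-- `c` is the concatenation "`a`, then `b`". -/
def IsConcat {x y z : M} (a : APath L x y) (b : APath L y z) (c : APath L x z) : Prop :=
  (∀ t ∈ Icc (0 : ℝ) (1 / 2), c.at t = scale 2 (a.at (2 * t))) ∧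
  (∀ t ∈ Icc (1 / 2 : ℝ) 1, c.at t = scale 2 (b.at (2 * t - 1)))

/-- The groupoid structure `S` on classes of `A`-paths is the one given by concatenation: units and
inverses are represented by unit paths and inverse paths, and a product is represented by the
concatenation of the representatives, if this concatenation is smooth, and in general by the
concatenation of their reparametrizations by any cut-off function. -/
structure IsConcatenationStructure {Hom : M → M → Type*} (S : GroupoidOver Hom)
    (cls : ∀ x y, APath L x y → Hom x y) : Prop where
  one_eq : ∀ x, ∃ e : APath L x x, IsUnitPath e ∧ S.one x = cls x x e
  inv_eq : ∀ {x y} (a : APath L x y), ∃ b : APath L y x,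
    IsInverse a b ∧ S.inv (cls x y a) = cls y x b
  comp_eq : ∀ {x y z} (a : APath L x y) (b : APath L y z) (c : APath L x z), IsConcat a b c →
    S.comp (cls y z b) (cls x y a) = cls x z c
  comp_reparam : ∀ (τ : ℝ → ℝ), IsCutoff τ → ∀ {x y z} (a : APath L x y) (b : APath L y z),
    ∃ (a' : APath L x y) (b' : APath L y z) (c : APath L x z),
      IsReparam τ a a' ∧ IsReparam τ b b' ∧ IsConcat a' b' c ∧
      S.comp (cls y z b) (cls x y a) = cls x z c

end Concatenation

end Weinstein

end

/-! A homotopy of morphisms `T I^n → A` is a morphism `T I^(n+1) → A`, so every homotopy needed here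
is obtained by two operations on morphisms of cubes. The first is the pullback along a smooth map
`I^m → I^n`. The second is the gluing of two morphisms along a wall, on each side of which they have
been reparametrized by a cut-off function: both are then constant across the wall, hence agree near
it. Gluing in the last coordinate makes homotopies transitive and gluing in another one makes them
compatible with concatenation.

The pullback of an `A`-path along a map `I² → I` is a thin homotopy, because `∧² (T I) = 0`. Hence
two pullbacks of a path along maps `f, g : I → I` with the same end points are thinly homotopic, by
interpolating between `f` and `g`, and the groupoid laws hold already up to thin homotopy since both
sides of each law are pullbacks of a single path. Finally, a thin homotopy is an `A`-homotopy, so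
two classes in `P₁` are the source and target of an element of `P₂` if and only if their
representatives are `A`-homotopic. -/

noncomputable section

namespace Weinstein

open Filter Topology Function

section Tensoriality

variable {E : Type*} [NormedAddCommGroup E] [NormedSpace ℝ E]
  {M : Type*} [TopologicalSpace M] [ChartedSpace E M]

lemma exists_bump [FiniteDimensional ℝ E] [T2Space M] [IsManifold 𝓘(ℝ, E) ∞ M] {x : M} {U : Set M}
    (hU : U ∈ 𝓝 x) : ∃ ψ : C^∞⟮𝓘(ℝ, E), M; 𝓘(ℝ, ℝ), ℝ⟯, ψ x = 1 ∧ tsupport ψ ⊆ U := by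
  obtain ⟨f, -, hf⟩ := (SmoothBumpFunction.nhds_basis_tsupport (I := 𝓘(ℝ, E)) x).mem_iff.1 hU
  exact ⟨⟨f, f.contMDiff⟩, f.eq_one, hf⟩

lemma dirDeriv_add {f g : M → ℝ} {x : M} (hf : MDifferentiableAt 𝓘(ℝ, E) 𝓘(ℝ, ℝ) f x)
    (hg : MDifferentiableAt 𝓘(ℝ, E) 𝓘(ℝ, ℝ) g x) (v : TangentSpace 𝓘(ℝ, E) x) :
    dirDeriv (fun y => f y + g y) x v = dirDeriv f x v + dirDeriv g x v :=
  congrArg (fun T : E →L[ℝ] ℝ => T v) (mfderiv_add hf hg)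

lemma dirDeriv_mul {f g : M → ℝ} {x : M} (hf : MDifferentiableAt 𝓘(ℝ, E) 𝓘(ℝ, ℝ) f x)
    (hg : MDifferentiableAt 𝓘(ℝ, E) 𝓘(ℝ, ℝ) g x) (v : TangentSpace 𝓘(ℝ, E) x) :
    dirDeriv (fun y => f y * g y) x v = f x * dirDeriv g x v + g x * dirDeriv f x v :=
  congrArg (fun T : E →L[ℝ] ℝ => T v) (hf.hasMFDerivAt.mul hg.hasMFDerivAt).mfderiv

lemma dirDeriv_apply_add (f : M → ℝ) (x : M) (v w : TangentSpace 𝓘(ℝ, E) x) :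
    dirDeriv f x (v + w) = dirDeriv f x v + dirDeriv f x w := map_add _ v w

lemma dirDeriv_apply_smul (f : M → ℝ) (x : M) (c : ℝ) (v : TangentSpace 𝓘(ℝ, E) x) :
    dirDeriv f x (c • v) = c * dirDeriv f x v := map_smul _ c v

variable {F : Type*} [NormedAddCommGroup F] [NormedSpace ℝ F]
  {A : M → Type*} [TopologicalSpace (TotalSpace F A)]
  [∀ x, AddCommGroup (A x)] [∀ x, Module ℝ (A x)] [∀ x, TopologicalSpace (A x)]
  [FiberBundle F A] [VectorBundle ℝ F A]

lemma exists_section_eq [FiniteDimensional ℝ E] [T2Space M] [IsManifold 𝓘(ℝ, E) ∞ M]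
    [ContMDiffVectorBundle ∞ F A 𝓘(ℝ, E)] {x : M} (v : A x) :
    ∃ X : Cₛ^∞⟮𝓘(ℝ, E); F, A⟯, X x = v := by
  obtain ⟨s, hs, hX⟩ := FiberBundle.exists_contMDiffOn_extend (k := ∞) 𝓘(ℝ, E) F v
  obtain ⟨ψ, hψ, hsupp⟩ := exists_bump (E := E) (interior_mem_nhds.2 hs)
  refine ⟨⟨_, ContMDiffOn.smul_section_of_tsupport ψ.contMDiff.contMDiffOn isOpen_interior hsupp
    (hX.mono interior_subset)⟩, ?_⟩
  simp [hψ]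

section Pairing

variable (θ : DualSection E M F A)

lemma DualSection.pair_add (x : M) (v w : A x) :
    θ.pair x (v + w) = θ.pair x v + θ.pair x w := map_add (θ x) v w

lemma DualSection.pair_smul (x : M) (c : ℝ) (v : A x) :
    θ.pair x (c • v) = c * θ.pair x v := map_smul (θ x) c v

lemma DualSection.pair_neg (x : M) (v : A x) : θ.pair x (-v) = -θ.pair x v := map_neg (θ x) v

lemma DualSection.mdifferentiableAt_pair (X : Cₛ^∞⟮𝓘(ℝ, E); F, A⟯) (x : M) :
    MDifferentiableAt 𝓘(ℝ, E) 𝓘(ℝ, ℝ) (fun y => θ.pair y (X y)) x := by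
  have h := ContMDiffAt.clm_bundle_apply (E₂ := Bundle.Trivial M ℝ) (F₂ := ℝ)
    (θ.contMDiff x) (X.contMDiff x)
  exact ((contMDiffAt_totalSpace).1 h).2.mdifferentiableAt (by simp)

end Pairing

lemma section_sum_apply {ι : Type*} [Fintype ι] (Z : ι → Cₛ^∞⟮𝓘(ℝ, E); F, A⟯) (x : M) :
    (∑ i, Z i) x = ∑ i, Z i x :=
  (congrFun (map_sum (ContMDiffSection.coeAddHom 𝓘(ℝ, E) F ∞ A) Z Finset.univ) x).trans
    (Finset.sum_apply _ _ _)

section Frame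

variable [ContMDiffVectorBundle ∞ F A 𝓘(ℝ, E)] [FiniteDimensional ℝ F]

/-- Expansion in a local frame, with one factor `ψ` used to extend the frame and the other to
extend the coefficients. -/
lemma exists_funSmul_eq_sum (x : M) {ψ : C^∞⟮𝓘(ℝ, E), M; 𝓘(ℝ, ℝ), ℝ⟯}
    (hψ : tsupport ψ ⊆ (trivializationAt F A x).baseSet) (Y : Cₛ^∞⟮𝓘(ℝ, E); F, A⟯) :
    ∃ (n : ℕ) (g : Fin n → C^∞⟮𝓘(ℝ, E), M; 𝓘(ℝ, ℝ), ℝ⟯) (Z : Fin n → Cₛ^∞⟮𝓘(ℝ, E); F, A⟯),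
      (∀ i y, Y y = 0 → g i y = 0) ∧ funSmul ψ (funSmul ψ Y) = ∑ i, funSmul (g i) (Z i) := by
  have : ContMDiffVectorBundle 1 F A 𝓘(ℝ, E) := .of_le (n := ∞) (by simp)
  let t := trivializationAt F A x
  let b := Module.finBasis ℝ F
  let Z i : Cₛ^∞⟮𝓘(ℝ, E); F, A⟯ := ⟨_, ContMDiffOn.smul_section_of_tsupport
    ψ.contMDiff.contMDiffOn t.open_baseSet hψ (t.contMDiffOn_localFrame_baseSet ∞ b i)⟩
  let g i : C^∞⟮𝓘(ℝ, E), M; 𝓘(ℝ, ℝ), ℝ⟯ :=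
    ⟨fun y => ψ y • (LinearMap.piApply (t.localFrameCoeff 𝓘(ℝ, E) b i)) Y y, by
      refine contMDiff_of_tsupport fun y hy => ?_
      have hy' : y ∈ t.baseSet := hψ (tsupport_smul_subset_left _ _ hy)
      exact ψ.contMDiff.contMDiffAt.smul (contMDiffAt_localFrameCoeff b hy' (Y.contMDiff y) i)⟩
  have hg i y : g i y = ψ y • t.localFrameCoeff 𝓘(ℝ, E) b i y (Y y) := rfl
  have hZ i y : Z i y = ψ y • t.localFrame b i y := rfl
  refine ⟨_, g, Z, fun i y hy => by rw [hg, hy, map_zero, smul_zero], ?_⟩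
  ext y
  have hsum : (∑ i, funSmul (g i) (Z i)) y = ∑ i, g i y • Z i y := section_sum_apply _ y
  have hsmul : funSmul ψ (funSmul ψ Y) y = ψ y • ψ y • Y y := rfl
  rw [hsum, hsmul]
  by_cases hy : y ∈ t.baseSet
  · conv_lhs => rw [t.eq_sum_localFrameCoeff_smul (I := 𝓘(ℝ, E)) (b := b) (s := Y) hy]
    rw [Finset.smul_sum, Finset.smul_sum]
    refine Finset.sum_congr rfl fun i _ => ?_
    rw [hg, hZ, smul_assoc, smul_comm _ (ψ y) (t.localFrame b i y)]
  · have h0 : ψ y = 0 := image_eq_zero_of_notMem_tsupport fun h => hy (hψ h)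
    simp only [hg, hZ, h0, zero_smul, Finset.sum_const_zero]

variable [FiniteDimensional ℝ E] [T2Space M] [IsManifold 𝓘(ℝ, E) ∞ M]

lemma eq_zero_of_forall_funSmul (φ : Cₛ^∞⟮𝓘(ℝ, E); F, A⟯ →ₗ[ℝ] ℝ) {x : M}
    (hφ : ∀ f Y, φ (funSmul f Y) = f x * φ Y) {Y : Cₛ^∞⟮𝓘(ℝ, E); F, A⟯} (hY : Y x = 0) :
    φ Y = 0 := by
  obtain ⟨ψ, hψ, hsupp⟩ := exists_bump (E := E) ((trivializationAt F A x).open_baseSet.mem_nhds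
    (FiberBundle.mem_baseSet_trivializationAt F A x))
  obtain ⟨n, g, Z, hg, hsum⟩ := exists_funSmul_eq_sum x hsupp Y
  calc φ Y = φ (funSmul ψ (funSmul ψ Y)) := by rw [hφ, hφ, hψ, one_mul, one_mul]
    _ = ∑ i, g i x * φ (Z i) := by rw [hsum, map_sum]; exact Finset.sum_congr rfl fun i _ => hφ _ _
    _ = 0 := Finset.sum_eq_zero fun i _ => by rw [hg i x hY, zero_mul]

end Frame

namespace LieAlgebroid

variable [IsManifold 𝓘(ℝ, E) ∞ M] (L : LieAlgebroid E M F A) (θ : DualSection E M F A)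
  (X Y Z : Cₛ^∞⟮𝓘(ℝ, E); F, A⟯) (x : M)

lemma bracket_swap : L.bracket Y X = -L.bracket X Y := by
  have h := L.bracket_self (X + Y)
  simp only [map_add, LinearMap.add_apply, L.bracket_self, zero_add, add_zero] at h
  exact eq_neg_of_add_eq_zero_left h

lemma d_swap : L.d θ Y X x = -L.d θ X Y x := by
  have h : θ.pair x (L.bracket Y X x) = -θ.pair x (L.bracket X Y x) := by
    rw [L.bracket_swap X Y]
    exact θ.pair_neg x _
  simp only [LieAlgebroid.d, h]
  ring

lemma d_self : L.d θ X X x = 0 := self_eq_neg.1 (L.d_swap θ X X x)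

lemma d_add_right : L.d θ X (Y + Z) x = L.d θ X Y x + L.d θ X Z x := by
  have hpair : (fun y => θ.pair y ((Y + Z) y)) = fun y => θ.pair y (Y y) + θ.pair y (Z y) :=
    funext fun y => θ.pair_add y _ _
  have hanchor : L.anchor x ((Y + Z) x) = L.anchor x (Y x) + L.anchor x (Z x) :=
    map_add (L.anchor x) _ _
  have hbracket : θ.pair x (L.bracket X (Y + Z) x)
      = θ.pair x (L.bracket X Y x) + θ.pair x (L.bracket X Z x) := by
    rw [map_add]
    exact θ.pair_add x _ _
  rw [LieAlgebroid.d, hpair, hanchor, hbracket, dirDeriv_apply_add,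
    dirDeriv_add (θ.mdifferentiableAt_pair Y x) (θ.mdifferentiableAt_pair Z x)]
  simp only [LieAlgebroid.d]
  ring

lemma d_funSmul_right (f : C^∞⟮𝓘(ℝ, E), M; 𝓘(ℝ, ℝ), ℝ⟯) :
    L.d θ X (funSmul f Y) x = f x * L.d θ X Y x := by
  have hpair : (fun y => θ.pair y (funSmul f Y y)) = fun y => f y * θ.pair y (Y y) :=
    funext fun y => θ.pair_smul y _ _
  have hanchor : L.anchor x (funSmul f Y x) = f x • L.anchor x (Y x) := map_smul (L.anchor x) _ _
  rw [LieAlgebroid.d, hpair, hanchor, L.leibniz, θ.pair_add, θ.pair_smul, θ.pair_smul,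
    dirDeriv_apply_smul,
    dirDeriv_mul (f.contMDiff.mdifferentiable (by simp) x) (θ.mdifferentiableAt_pair Y x)]
  simp only [LieAlgebroid.d]
  ring

/-- The map `Y ↦ (d_A θ)(X, Y)(x)`, as a linear functional on sections. -/
def dRight : Cₛ^∞⟮𝓘(ℝ, E); F, A⟯ →ₗ[ℝ] ℝ where
  toFun Y := L.d θ X Y x
  map_add' Y Z := L.d_add_right θ X Y Z x
  map_smul' c Y := L.d_funSmul_right θ X Y x ⟨fun _ => c, contMDiff_const⟩

lemma d_sum_smul {ι : Type*} [Fintype ι] (c c' : ι → ℝ) (X : ι → Cₛ^∞⟮𝓘(ℝ, E); F, A⟯) :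
    L.d θ (∑ i, c i • X i) (∑ i, c' i • X i) x
      = ∑ i, ∑ j, c i * c' j * L.d θ (X i) (X j) x := by
  have h (Z : Cₛ^∞⟮𝓘(ℝ, E); F, A⟯) (c : ι → ℝ) :
      L.d θ Z (∑ i, c i • X i) x = ∑ i, c i * L.d θ Z (X i) x := by
    have := map_sum (L.dRight θ Z x) (fun i => c i • X i) Finset.univ
    simp only [map_smul, smul_eq_mul] at this
    exact this
  rw [h, Finset.sum_comm]
  refine Finset.sum_congr rfl fun j _ => ?_
  rw [L.d_swap, h, ← Finset.sum_neg_distrib, Finset.mul_sum]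
  refine Finset.sum_congr rfl fun i _ => ?_
  rw [L.d_swap θ (X i) (X j)]
  ring

variable [ContMDiffVectorBundle ∞ F A 𝓘(ℝ, E)] [FiniteDimensional ℝ E] [FiniteDimensional ℝ F]
  [T2Space M] {X Y x}

lemma d_congr_right {Y' : Cₛ^∞⟮𝓘(ℝ, E); F, A⟯} (hY : Y x = Y' x) :
    L.d θ X Y x = L.d θ X Y' x := by
  have h0 : (Y - Y') x = 0 := sub_eq_zero.2 hY
  have h := eq_zero_of_forall_funSmul (L.dRight θ X x) (fun f Y => L.d_funSmul_right θ X Y x f) h0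
  rwa [map_sub, sub_eq_zero] at h

lemma d_congr {X' Y' : Cₛ^∞⟮𝓘(ℝ, E); F, A⟯} (hX : X x = X' x) (hY : Y x = Y' x) :
    L.d θ X Y x = L.d θ X' Y' x := by
  rw [L.d_congr_right θ hY, L.d_swap θ Y' X, L.d_congr_right θ hX, ← L.d_swap]

end LieAlgebroid

end Tensoriality

section Jacobian

/-- The Jacobian matrix of a map between cubes: `jac φ p j k` is `∂_j φ_k` at `p`. -/
def jac {m n : ℕ} (φ : (Fin m → ℝ) → (Fin n → ℝ)) (p : Fin m → ℝ) (j : Fin m) (k : Fin n) : ℝ :=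
  fderiv ℝ φ p (Pi.single j 1) k

variable {m n : ℕ} {φ : (Fin m → ℝ) → (Fin n → ℝ)}

lemma fderiv_single_eq_sum (φ : (Fin m → ℝ) → (Fin n → ℝ)) (p : Fin m → ℝ) (j : Fin m) :
    fderiv ℝ φ p (Pi.single j 1) = ∑ k, jac φ p j k • Pi.single k (1 : ℝ) := by
  funext k
  simp [jac, Finset.sum_apply, Pi.single_apply]

lemma contDiff_jac (hφ : ContDiff ℝ ∞ φ) (j : Fin m) (k : Fin n) :
    ContDiff ℝ ∞ (fun p => jac φ p j k) :=
  contDiff_pi.1 ((hφ.fderiv_right (by simp)).clm_apply contDiff_const) k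

lemma fderiv_jac_eq (hφ : ContDiff ℝ ∞ φ) (p : Fin m → ℝ) (i j : Fin m) (k : Fin n) :
    fderiv ℝ (fun p => jac φ p j k) p (Pi.single i 1)
      = fderiv ℝ (fderiv ℝ φ) p (Pi.single i 1) (Pi.single j 1) k := by
  have hφ' : DifferentiableAt ℝ (fderiv ℝ φ) p :=
    (hφ.fderiv_right (m := ∞) (by simp)).differentiable (by simp) p
  have h := hφ'.hasFDerivAt.clm_apply (hasFDerivAt_const (Pi.single j 1 : Fin m → ℝ) p)
  change fderiv ℝ (fun p => fderiv ℝ φ p (Pi.single j 1) k) p _ = _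
  rw [(hasFDerivAt_pi'.1 h k).fderiv]
  simp

lemma fderiv_jac_symm (hφ : ContDiff ℝ ∞ φ) (p : Fin m → ℝ) (i j : Fin m) (k : Fin n) :
    fderiv ℝ (fun p => jac φ p j k) p (Pi.single i 1)
      = fderiv ℝ (fun p => jac φ p i k) p (Pi.single j 1) := by
  have hsymm : IsSymmSndFDerivAt ℝ φ p := hφ.contDiffAt.isSymmSndFDerivAt (by
    rw [minSmoothness_of_isRCLikeNormedField]
    exact WithTop.coe_le_coe.2 le_top)
  rw [fderiv_jac_eq hφ, fderiv_jac_eq hφ, hsymm.eq]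

end Jacobian

section Pullback

variable {E : Type*} [NormedAddCommGroup E] [NormedSpace ℝ E]
  {M : Type*} [TopologicalSpace M] [ChartedSpace E M]
  {F : Type*} [NormedAddCommGroup F] [NormedSpace ℝ F]
  {A : M → Type*} [TopologicalSpace (TotalSpace F A)]
  [∀ x, AddCommGroup (A x)] [∀ x, Module ℝ (A x)] [∀ x, TopologicalSpace (A x)]
  [FiberBundle F A] [VectorBundle ℝ F A]

lemma contMDiffWithinAt_sum_smul {V : Type*} [NormedAddCommGroup V] [NormedSpace ℝ V]
    {ι : Type*} [Fintype ι] {b : V → M} {v : ι → ∀ p, A (b p)} {c : ι → V → ℝ} {s : Set V} {p₀ : V}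
    (hb : ContMDiffWithinAt 𝓘(ℝ, V) 𝓘(ℝ, E) ∞ b s p₀)
    (hv : ∀ i, ContMDiffWithinAt 𝓘(ℝ, V) (𝓘(ℝ, E).prod 𝓘(ℝ, F)) ∞
      (fun p => (⟨b p, v i p⟩ : TotalSpace F A)) s p₀)
    (hc : ∀ i, ContDiffWithinAt ℝ ∞ (c i) s p₀) :
    ContMDiffWithinAt 𝓘(ℝ, V) (𝓘(ℝ, E).prod 𝓘(ℝ, F)) ∞
      (fun p => (⟨b p, ∑ i, c i p • v i p⟩ : TotalSpace F A)) s p₀ := by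
  rw [contMDiffWithinAt_totalSpace]
  refine ⟨hb, ?_⟩
  let t := trivializationAt F A (b p₀)
  have hx : b p₀ ∈ t.baseSet := FiberBundle.mem_baseSet_trivializationAt F A _
  have hlin (p : V) (hp : b p ∈ t.baseSet) : (t ⟨b p, ∑ i, c i p • v i p⟩).2
      = ∑ i, c i p • (t ⟨b p, v i p⟩).2 := by
    have h (w : A (b p)) : (t ⟨b p, w⟩).2 = t.linearMapAt ℝ (b p) w := by
      rw [t.linearMapAt_apply, if_pos hp]
    simp only [h, map_sum, map_smul]
  have hsum : ContMDiffWithinAt 𝓘(ℝ, V) 𝓘(ℝ, F) ∞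
      (fun p => ∑ i, c i p • (t ⟨b p, v i p⟩).2) s p₀ := by
    rw [contMDiffWithinAt_iff_contDiffWithinAt]
    refine ContDiffWithinAt.sum fun i _ => (hc i).smul ?_
    exact ((contMDiffWithinAt_totalSpace).1 (hv i)).2.contDiffWithinAt
  refine hsum.congr_of_eventuallyEq ?_ (hlin _ hx)
  exact (hb.continuousWithinAt.eventually (t.open_baseSet.mem_nhds hx)).mono hlin

lemma DualSection.pair_sum_smul (θ : DualSection E M F A) (x : M) {ι : Type*} [Fintype ι]
    (c : ι → ℝ) (v : ι → A x) : θ.pair x (∑ i, c i • v i) = ∑ i, c i * θ.pair x (v i) :=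
  (map_sum (θ x) (fun i => c i • v i) Finset.univ).trans
    (Finset.sum_congr rfl fun _ _ => θ.pair_smul x _ _)

namespace CubeMorphism

variable [IsManifold 𝓘(ℝ, E) ∞ M] {L : LieAlgebroid E M F A} {m n : ℕ} (σ : CubeMorphism L n)

/-- The `j`-th component `∑ k, ∂_j φ_k • (σ_k ∘ φ)` of the pullback of `σ` along `φ`. -/
def pullComp (φ : (Fin m → ℝ) → (Fin n → ℝ)) (j : Fin m) (p : Fin m → ℝ) : A (σ.base (φ p)) :=
  ∑ k, jac φ p j k • σ.comp k (φ p)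

variable {φ : (Fin m → ℝ) → (Fin n → ℝ)} (hφ : ContDiff ℝ ∞ φ) (hm : MapsTo φ (cube m) (cube n))
  {p : Fin m → ℝ} (hp : p ∈ cube m)

include hφ hm

lemma contMDiffOn_pullComp [NeZero n] (j : Fin m) :
    ContMDiffOn 𝓘(ℝ, Fin m → ℝ) (𝓘(ℝ, E).prod 𝓘(ℝ, F)) ∞
      (fun p => (⟨σ.base (φ p), σ.pullComp φ j p⟩ : TotalSpace F A)) (cube m) := fun p hp =>
  have hφ' : ContMDiffWithinAt 𝓘(ℝ, Fin m → ℝ) 𝓘(ℝ, Fin n → ℝ) ∞ φ (cube m) p :=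
    hφ.contMDiff.contMDiffAt.contMDiffWithinAt
  contMDiffWithinAt_sum_smul ((σ.contMDiffOn_base 0 _ (hm hp)).comp p hφ' hm)
    (fun k => (σ.smooth k _ (hm hp)).comp p hφ' hm)
    fun k => (contDiff_jac hφ j k).contDiffAt.contDiffWithinAt

include hp

lemma anchor_pullComp [NeZero n] (j : Fin m) :
    L.anchor (σ.base (φ p)) (σ.pullComp φ j p)
      = mfderivWithin 𝓘(ℝ, Fin m → ℝ) 𝓘(ℝ, E) (fun q => σ.base (φ q)) (cube m) p
        (Pi.single j (1 : ℝ) : Fin m → ℝ) := by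
  let ρ : A (σ.base (φ p)) →L[ℝ] E := L.anchor (σ.base (φ p))
  let D : (Fin n → ℝ) →L[ℝ] E := mfderivWithin 𝓘(ℝ, Fin n → ℝ) 𝓘(ℝ, E) σ.base (cube n) (φ p)
  have hφ' : HasMFDerivWithinAt 𝓘(ℝ, Fin m → ℝ) 𝓘(ℝ, Fin n → ℝ) φ (cube m) p (fderiv ℝ φ p) :=
    ((hφ.differentiable (by simp) p).hasFDerivAt.hasFDerivWithinAt).hasMFDerivWithinAt
  have hbase := ((σ.contMDiffOn_base 0 _ (hm hp)).mdifferentiableWithinAt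
    (by simp)).hasMFDerivWithinAt
  have hchain := (hbase.comp p hφ' hm).mfderivWithin ((uniqueDiffOn_cube m).uniqueMDiffOn p hp)
  refine Eq.trans (b := D (fderiv ℝ φ p (Pi.single j 1))) ?_
    (congrArg (fun T : (Fin m → ℝ) →L[ℝ] E => T (Pi.single j 1)) hchain).symm
  calc ρ (σ.pullComp φ j p) = ∑ k, jac φ p j k • ρ (σ.comp k (φ p)) := by
        rw [pullComp, map_sum]
        exact Finset.sum_congr rfl fun k _ => map_smul _ _ _
    _ = ∑ k, jac φ p j k • D (Pi.single k 1) :=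
        Finset.sum_congr rfl fun k _ => congrArg _ (σ.anchor_eq k _ (hm hp))
    _ = D (fderiv ℝ φ p (Pi.single j 1)) := by
        rw [fderiv_single_eq_sum, map_sum]
        exact Finset.sum_congr rfl fun k _ => (map_smul D _ _).symm

variable [ContMDiffVectorBundle ∞ F A 𝓘(ℝ, E)] (θ : DualSection E M F A)

lemma fderivWithin_pair_pullComp (i j : Fin m) :
    fderivWithin ℝ (fun q => θ.pair (σ.base (φ q)) (σ.pullComp φ j q)) (cube m) p (Pi.single i 1)
      = (∑ k, ∑ l, jac φ p j k * jac φ p i l *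
          fderivWithin ℝ (fun q => θ.pair (σ.base q) (σ.comp k q)) (cube n) (φ p) (Pi.single l 1))
        + ∑ k, θ.pair (σ.base (φ p)) (σ.comp k (φ p)) *
          fderiv ℝ (fun q => jac φ q j k) p (Pi.single i 1) := by
  let u (k : Fin n) (q : Fin n → ℝ) : ℝ := θ.pair (σ.base q) (σ.comp k q)
  have hu (k : Fin n) : HasFDerivWithinAt (fun q => u k (φ q))
      ((fderivWithin ℝ (u k) (cube n) (φ p)).comp (fderiv ℝ φ p)) (cube m) p :=
    (σ.differentiableOn_pair θ k _ (hm hp)).hasFDerivWithinAt.comp p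
      (hφ.differentiable (by simp) p).hasFDerivAt.hasFDerivWithinAt hm
  have hjac (k : Fin n) : HasFDerivWithinAt (fun q => jac φ q j k)
      (fderiv ℝ (fun q => jac φ q j k) p) (cube m) p :=
    ((contDiff_jac hφ j k).differentiable (by simp) p).hasFDerivAt.hasFDerivWithinAt
  have hpair : (fun q => θ.pair (σ.base (φ q)) (σ.pullComp φ j q))
      = fun q => ∑ k, jac φ q j k * u k (φ q) := funext fun q => θ.pair_sum_smul _ _ _
  have hsum : HasFDerivWithinAt (fun q => ∑ k, jac φ q j k * u k (φ q)) _ (cube m) p :=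
    HasFDerivWithinAt.fun_sum fun k _ => (hjac k).mul (hu k)
  rw [hpair, hsum.fderivWithin (uniqueDiffOn_cube m p hp), ← Finset.sum_add_distrib]
  simp only [_root_.sum_apply, _root_.add_apply, _root_.smul_apply,
    ContinuousLinearMap.comp_apply, smul_eq_mul]
  refine Finset.sum_congr rfl fun k _ => ?_
  rw [fderiv_single_eq_sum φ p i, map_sum, Finset.mul_sum]
  congr 1
  refine Finset.sum_congr rfl fun l _ => ?_
  rw [map_smul, smul_eq_mul, mul_assoc]

omit hφ hm hp

variable [FiniteDimensional ℝ E] [FiniteDimensional ℝ F] [T2Space M]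

lemma d_eq_of_mem {q : Fin n → ℝ} (hq : q ∈ cube n) (i j : Fin n)
    {X Y : Cₛ^∞⟮𝓘(ℝ, E); F, A⟯} (hX : X (σ.base q) = σ.comp i q) (hY : Y (σ.base q) = σ.comp j q) :
    fderivWithin ℝ (fun q => θ.pair (σ.base q) (σ.comp j q)) (cube n) q (Pi.single i 1)
      - fderivWithin ℝ (fun q => θ.pair (σ.base q) (σ.comp i q)) (cube n) q (Pi.single j 1)
      = L.d θ X Y (σ.base q) := by
  rcases lt_trichotomy i j with h | rfl | h
  · exact σ.d_eq i j h q hq θ X Y hX hY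
  · rw [L.d_congr θ (hX.trans hY.symm) (rfl : Y (σ.base q) = _), L.d_self, sub_self]
  · rw [L.d_swap, ← σ.d_eq j i h q hq θ Y X hY hX, neg_sub]

include hφ hm hp

lemma d_pullComp (i j : Fin m) {X Y : Cₛ^∞⟮𝓘(ℝ, E); F, A⟯}
    (hX : X (σ.base (φ p)) = σ.pullComp φ i p) (hY : Y (σ.base (φ p)) = σ.pullComp φ j p) :
    fderivWithin ℝ (fun q => θ.pair (σ.base (φ q)) (σ.pullComp φ j q)) (cube m) p (Pi.single i 1)
      - fderivWithin ℝ (fun q => θ.pair (σ.base (φ q)) (σ.pullComp φ i q)) (cube m) p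
        (Pi.single j 1)
      = L.d θ X Y (σ.base (φ p)) := by
  choose Z hZ using fun k : Fin n => exists_section_eq (E := E) (F := F) (σ.comp k (φ p))
  have hsum (i : Fin m) : (∑ k, jac φ p i k • Z k) (σ.base (φ p)) = σ.pullComp φ i p := by
    refine (section_sum_apply _ _).trans (Finset.sum_congr rfl fun k _ => ?_)
    exact congrArg _ (hZ k)
  rw [L.d_congr θ (hX.trans (hsum i).symm) (hY.trans (hsum j).symm), L.d_sum_smul,
    σ.fderivWithin_pair_pullComp hφ hm hp, σ.fderivWithin_pair_pullComp hφ hm hp]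
  simp only [← σ.d_eq_of_mem θ (hm hp) _ _ (hZ _) (hZ _), fderiv_jac_symm hφ p j i, mul_sub,
    Finset.sum_sub_distrib]
  rw [add_sub_add_right_eq_sub, Finset.sum_comm]
  congr 1
  exact Finset.sum_congr rfl fun l _ => Finset.sum_congr rfl fun k _ => by ring

omit hp

/-- The pullback of a morphism `T I^n → A` along a smooth map `I^m → I^n`. -/
def pull [NeZero n] : CubeMorphism L m where
  base p := σ.base (φ p)
  comp := σ.pullComp φ
  smooth := σ.contMDiffOn_pullComp hφ hm
  anchor_eq j _ hp := σ.anchor_pullComp hφ hm hp j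
  d_eq i j _ _ hp θ _ _ := σ.d_pullComp hφ hm hp θ i j

end CubeMorphism

end Pullback

section Gluing

lemma contMDiffWithinAt_glue {V : Type*} [NormedAddCommGroup V] [NormedSpace ℝ V]
    {E' : Type*} [NormedAddCommGroup E'] [NormedSpace ℝ E'] {H : Type*} [TopologicalSpace H]
    {I : ModelWithCorners ℝ E' H} [I.Boundaryless] {N : Type*} [TopologicalSpace N]
    [ChartedSpace H N] [IsManifold I ∞ N] {f g h k : V → N} {s : Set V} {p : V} (hp : p ∈ s)
    (hf : ContMDiffWithinAt 𝓘(ℝ, V) I ∞ f s p) (hg : ContMDiffWithinAt 𝓘(ℝ, V) I ∞ g s p)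
    (hh : ContMDiffWithinAt 𝓘(ℝ, V) I ∞ h s p) (hfp : f p = h p) (hgp : g p = h p)
    (hk : ∀ q ∈ s, (k q = f q ∧ g q = h q) ∨ (k q = g q ∧ f q = h q)) :
    ContMDiffWithinAt 𝓘(ℝ, V) I ∞ k s p := by
  -- In a chart `e` at `h p`, the function `k` is the smooth function `f + g - h`.
  let e := extChartAt I (h p)
  have hchart (f : V → N) (hf : ContMDiffWithinAt 𝓘(ℝ, V) I ∞ f s p) (hfp : f p = h p) :
      ContDiffWithinAt ℝ ∞ (fun q => e (f q)) s p := by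
    rw [← contMDiffWithinAt_iff_contDiffWithinAt]
    exact ContMDiffAt.comp_contMDiffWithinAt p (hfp ▸ contMDiffAt_extChartAt) hf
  have hsum : ContMDiffWithinAt 𝓘(ℝ, V) 𝓘(ℝ, E') ∞ (fun q => e (f q) + e (g q) - e (h q)) s p :=
    (((hchart f hf hfp).add (hchart g hg hgp)).sub (hchart h hh rfl)).contMDiffWithinAt
  have hval : e (f p) + e (g p) - e (h p) = e (h p) := by rw [hfp, hgp, add_sub_cancel_right]
  have hsymm : ContMDiffAt 𝓘(ℝ, E') I ∞ e.symm (e (f p) + e (g p) - e (h p)) := by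
    rw [hval]
    exact (contMDiffOn_extChartAt_symm (h p)).contMDiffAt (extChartAt_target_mem_nhds (h p))
  have hsource : ∀ᶠ q in 𝓝[s] p, f q ∈ e.source ∧ g q ∈ e.source :=
    (hf.continuousWithinAt.eventually (hfp ▸ extChartAt_source_mem_nhds (h p))).and
      (hg.continuousWithinAt.eventually (hgp ▸ extChartAt_source_mem_nhds (h p)))
  have heq : ∀ q ∈ s, f q ∈ e.source ∧ g q ∈ e.source →
      k q = e.symm (e (f q) + e (g q) - e (h q)) := by
    rintro q hq ⟨hfq, hgq⟩
    rcases hk q hq with ⟨hkf, hgh⟩ | ⟨hkg, hfh⟩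
    · rw [hkf, hgh, add_sub_cancel_right, e.left_inv hfq]
    · rw [hkg, hfh, add_sub_cancel_left, e.left_inv hgq]
  refine (hsymm.comp_contMDiffWithinAt p hsum).congr_of_eventuallyEq ?_
    (heq p hp (hsource.self_of_nhdsWithin hp))
  filter_upwards [hsource, self_mem_nhdsWithin] with q hq hqs using heq q hqs hq

lemma fderivWithin_eq_of_eqOn_subset {V W : Type*} [NormedAddCommGroup V] [NormedSpace ℝ V]
    [NormedAddCommGroup W] [NormedSpace ℝ W] {f g : V → W} {s t : Set V} {p : V} (hts : t ⊆ s)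
    (hp : p ∈ t) (ht : UniqueDiffWithinAt ℝ t p) (hf : DifferentiableWithinAt ℝ f s p)
    (hg : DifferentiableWithinAt ℝ g s p) (h : EqOn f g t) :
    fderivWithin ℝ f s p = fderivWithin ℝ g s p :=
  ht.eq (hf.hasFDerivWithinAt.mono hts) ((hg.hasFDerivWithinAt.mono hts).congr h (h hp))

lemma uniqueDiffOn_cube_inter_le {n : ℕ} (i : Fin n) :
    UniqueDiffOn ℝ (cube n ∩ {q | q i ≤ 1 / 2}) := by
  refine uniqueDiffOn_convex ((convex_Icc _ _).inter
    (convex_halfSpace_le (LinearMap.proj (R := ℝ) (φ := fun _ => ℝ) i).isLinear _))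
    ⟨fun _ => 1 / 4, ?_⟩
  have hsub : (Set.univ.pi fun _ : Fin n => Ioo (0 : ℝ) (1 / 2)) ⊆
      cube n ∩ {q | q i ≤ 1 / 2} := fun p hp =>
    ⟨⟨fun i => (hp i trivial).1.le, fun i => (hp i trivial).2.le.trans (by norm_num)⟩,
      (hp i trivial).2.le⟩
  exact interior_maximal hsub (isOpen_set_pi finite_univ fun _ _ => isOpen_Ioo)
    fun _ _ => by norm_num

lemma uniqueDiffOn_cube_inter_ge {n : ℕ} (i : Fin n) :
    UniqueDiffOn ℝ (cube n ∩ {q | 1 / 2 ≤ q i}) := by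
  refine uniqueDiffOn_convex ((convex_Icc _ _).inter
    (convex_halfSpace_ge (LinearMap.proj (R := ℝ) (φ := fun _ => ℝ) i).isLinear _))
    ⟨fun _ => 3 / 4, ?_⟩
  have hsub : (Set.univ.pi fun _ : Fin n => Ioo (1 / 2 : ℝ) 1) ⊆
      cube n ∩ {q | 1 / 2 ≤ q i} := fun p hp =>
    ⟨⟨fun i => le_trans (by norm_num) (hp i trivial).1.le, fun i => (hp i trivial).2.le⟩,
      (hp i trivial).1.le⟩
  exact interior_maximal hsub (isOpen_set_pi finite_univ fun _ _ => isOpen_Ioo)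
    fun _ _ => by norm_num

variable {E : Type*} [NormedAddCommGroup E] [NormedSpace ℝ E]
  {M : Type*} [TopologicalSpace M] [ChartedSpace E M]

lemma mfderivWithin_eq_of_eqOn_subset {V : Type*} [NormedAddCommGroup V] [NormedSpace ℝ V]
    {f g : V → M} {s t : Set V} {p : V} (hts : t ⊆ s) (hp : p ∈ t)
    (ht : UniqueDiffWithinAt ℝ t p) (hf : MDifferentiableWithinAt 𝓘(ℝ, V) 𝓘(ℝ, E) f s p)
    (hg : MDifferentiableWithinAt 𝓘(ℝ, V) 𝓘(ℝ, E) g s p) (h : EqOn f g t) :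
    (mfderivWithin 𝓘(ℝ, V) 𝓘(ℝ, E) f s p : V →L[ℝ] E) = mfderivWithin 𝓘(ℝ, V) 𝓘(ℝ, E) g s p :=
  ht.uniqueMDiffWithinAt.eq (hf.hasMFDerivWithinAt.mono hts)
    ((hg.hasMFDerivWithinAt.mono hts).congr_of_eventuallyEq
      (h.eventuallyEq_of_mem self_mem_nhdsWithin) (h hp))

variable {F : Type*} [NormedAddCommGroup F] [NormedSpace ℝ F]
  {A : M → Type*} [TopologicalSpace (TotalSpace F A)]
  [∀ x, AddCommGroup (A x)] [∀ x, Module ℝ (A x)] [∀ x, TopologicalSpace (A x)]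
  [FiberBundle F A] [VectorBundle ℝ F A]

lemma DualSection.differentiableWithinAt_pair {V : Type*} [NormedAddCommGroup V] [NormedSpace ℝ V]
    (θ : DualSection E M F A) {f : V → TotalSpace F A} {s : Set V} {p : V}
    (hf : ContMDiffWithinAt 𝓘(ℝ, V) (𝓘(ℝ, E).prod 𝓘(ℝ, F)) ∞ f s p) :
    DifferentiableWithinAt ℝ (fun q => θ.pair (f q).1 (f q).2) s p := by
  have hbase := ((contMDiffWithinAt_totalSpace).1 hf).1
  have hpair := ContMDiffWithinAt.clm_bundle_apply (E₂ := Bundle.Trivial M ℝ) (F₂ := ℝ)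
    (θ.contMDiff.contMDiffAt.comp_contMDiffWithinAt p hbase) hf
  exact ((contMDiffWithinAt_totalSpace).1 hpair).2.contDiffWithinAt.differentiableWithinAt
    (by simp)

namespace CubeMorphism

variable [IsManifold 𝓘(ℝ, E) ∞ M] {L : LieAlgebroid E M F A} {n : ℕ}

/-- The morphisms in the family `f` fit together at `p`: a smaller piece of the cube through `p`,
on which derivatives are still unique, sees only the morphism `f p`. -/
def FitsAt (f : (Fin n → ℝ) → CubeMorphism L n) (p : Fin n → ℝ) : Prop :=
  ∃ t ⊆ cube n, p ∈ t ∧ UniqueDiffWithinAt ℝ t p ∧ ∀ q ∈ t, ∀ k, (f q).val k q = (f p).val k q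

variable (f : (Fin n → ℝ) → CubeMorphism L n)
  (hf : ∀ k, ContMDiffOn 𝓘(ℝ, Fin n → ℝ) (𝓘(ℝ, E).prod 𝓘(ℝ, F)) ∞ (fun q => (f q).val k q) (cube n))
  (hfit : ∀ p ∈ cube n, FitsAt f p)

section

include hf hfit

lemma anchor_eq_of_fitsAt {p : Fin n → ℝ} (hp : p ∈ cube n) (k : Fin n) :
    L.anchor ((f p).base p) ((f p).comp k p)
      = mfderivWithin 𝓘(ℝ, Fin n → ℝ) 𝓘(ℝ, E) (fun q => (f q).base q) (cube n) p
        (Pi.single k (1 : ℝ) : Fin n → ℝ) := by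
  obtain ⟨t, ht, hpt, hu, h⟩ := hfit p hp
  have hD : (mfderivWithin 𝓘(ℝ, Fin n → ℝ) 𝓘(ℝ, E) (fun q => (f q).base q) (cube n) p :
      (Fin n → ℝ) →L[ℝ] E) = mfderivWithin 𝓘(ℝ, Fin n → ℝ) 𝓘(ℝ, E) (f p).base (cube n) p :=
    mfderivWithin_eq_of_eqOn_subset ht hpt hu
      (((contMDiffWithinAt_totalSpace).1 (hf k p hp)).1.mdifferentiableWithinAt (by simp))
      (((f p).contMDiffOn_base k p hp).mdifferentiableWithinAt (by simp))
      fun q hq => congrArg TotalSpace.proj (h q hq k)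
  exact ((f p).anchor_eq k p hp).trans
    (congrArg (fun T : (Fin n → ℝ) →L[ℝ] E => T (Pi.single k 1)) hD).symm

lemma fderivWithin_pair_eq_of_fitsAt (θ : DualSection E M F A) {p : Fin n → ℝ} (hp : p ∈ cube n)
    (k : Fin n) :
    fderivWithin ℝ (fun q => θ.pair ((f q).base q) ((f q).comp k q)) (cube n) p
      = fderivWithin ℝ (fun q => θ.pair ((f p).base q) ((f p).comp k q)) (cube n) p := by
  obtain ⟨t, ht, hpt, hu, h⟩ := hfit p hp
  exact fderivWithin_eq_of_eqOn_subset ht hpt hu (θ.differentiableWithinAt_pair (hf k p hp))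
    (θ.differentiableWithinAt_pair ((f p).smooth k p hp))
    fun q hq => congrArg (fun v : TotalSpace F A => θ.pair v.1 v.2) (h q hq k)

end

/-- The morphism which is given by `f p` at the point `p`. -/
def patch : CubeMorphism L n where
  base p := (f p).base p
  comp k p := (f p).comp k p
  smooth := hf
  anchor_eq k _ hp := anchor_eq_of_fitsAt f hf hfit hp k
  d_eq i j hij p hp θ X Y hX hY := by
    rw [fderivWithin_pair_eq_of_fitsAt f hf hfit θ hp,
      fderivWithin_pair_eq_of_fitsAt f hf hfit θ hp]
    exact (f p).d_eq i j hij p hp θ X Y hX hY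

variable (σ σ' η : CubeMorphism L n) (i : Fin n)

/-- The family of morphisms given by `σ` for `p i ≤ 1/2` and by `σ'` for `p i > 1/2`. -/
def halves (p : Fin n → ℝ) : CubeMorphism L n := if p i ≤ 1 / 2 then σ else σ'

variable {σ σ' η i} {p : Fin n → ℝ}

lemma halves_of_le (hp : p i ≤ 1 / 2) : halves σ σ' i p = σ := if_pos hp

lemma halves_of_gt (hp : 1 / 2 < p i) : halves σ σ' i p = σ' := if_neg hp.not_ge

variable (hσ : ∀ p ∈ cube n, 1 / 2 ≤ p i → ∀ k, σ.val k p = η.val k p)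
  (hσ' : ∀ p ∈ cube n, p i ≤ 1 / 2 → ∀ k, σ'.val k p = η.val k p)

section

include hσ hσ'

lemma val_halves_of_ge (hp : p ∈ cube n) (h : 1 / 2 ≤ p i) (k : Fin n) :
    (halves σ σ' i p).val k p = σ'.val k p := by
  rcases h.eq_or_lt with h | h
  · rw [halves_of_le h.ge, hσ p hp h.le, hσ' p hp h.ge]
  · rw [halves_of_gt h]

lemma contMDiffOn_val_halves [ContMDiffVectorBundle ∞ F A 𝓘(ℝ, E)] (k : Fin n) :
    ContMDiffOn 𝓘(ℝ, Fin n → ℝ) (𝓘(ℝ, E).prod 𝓘(ℝ, F)) ∞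
      (fun q => (halves σ σ' i q).val k q) (cube n) := by
  have hcoord : Continuous fun q : Fin n → ℝ => q i := continuous_apply i
  intro p hp
  rcases lt_trichotomy (p i) (1 / 2) with h | h | h
  · refine (σ.smooth k p hp).congr_of_eventuallyEq ?_
      (congrArg (fun τ : CubeMorphism L n => τ.val k p) (halves_of_le h.le))
    filter_upwards [mem_nhdsWithin_of_mem_nhds (hcoord.continuousAt.eventually_lt
      continuousAt_const h)] with q hq
    exact congrArg (fun τ : CubeMorphism L n => τ.val k q) (halves_of_le (le_of_lt hq))
  · refine contMDiffWithinAt_glue hp (σ.smooth k p hp) (σ'.smooth k p hp) (η.smooth k p hp)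
      (hσ p hp h.ge k) (hσ' p hp h.le k) fun q hq => ?_
    rcases le_or_gt (q i) (1 / 2) with h | h
    · exact Or.inl ⟨congrArg (fun τ : CubeMorphism L n => τ.val k q) (halves_of_le h), hσ' q hq h k⟩
    · exact Or.inr ⟨congrArg (fun τ : CubeMorphism L n => τ.val k q) (halves_of_gt h),
        hσ q hq h.le k⟩
  · refine (σ'.smooth k p hp).congr_of_eventuallyEq ?_
      (congrArg (fun τ : CubeMorphism L n => τ.val k p) (halves_of_gt h))
    filter_upwards [mem_nhdsWithin_of_mem_nhds (continuousAt_const.eventually_lt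
      hcoord.continuousAt h)] with q hq
    exact congrArg (fun τ : CubeMorphism L n => τ.val k q) (halves_of_gt hq)

lemma fitsAt_halves (hp : p ∈ cube n) : FitsAt (halves σ σ' i) p := by
  rcases le_or_gt (p i) (1 / 2) with h | h
  · exact ⟨_, inter_subset_left, ⟨hp, h⟩, uniqueDiffOn_cube_inter_le i p ⟨hp, h⟩,
      fun q hq k => by rw [halves_of_le hq.2, halves_of_le h]⟩
  · exact ⟨_, inter_subset_left, ⟨hp, h.le⟩, uniqueDiffOn_cube_inter_ge i p ⟨hp, h.le⟩,
      fun q hq k => by rw [val_halves_of_ge hσ hσ' hq.1 hq.2 k, halves_of_gt h]⟩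

end

/-- The morphism given by `σ` for `p i ≤ 1/2` and by `σ'` for `p i ≥ 1/2`. It is smooth across the
wall, if a third morphism `η` agrees with `σ` after it, and with `σ'` before it. -/
def glue [ContMDiffVectorBundle ∞ F A 𝓘(ℝ, E)] : CubeMorphism L n :=
  patch (halves σ σ' i) (contMDiffOn_val_halves hσ hσ') fun _ => fitsAt_halves hσ hσ'

variable [ContMDiffVectorBundle ∞ F A 𝓘(ℝ, E)]

lemma glue_val_of_le (h : p i ≤ 1 / 2) (k : Fin n) : (glue hσ hσ').val k p = σ.val k p := by
  change (halves σ σ' i p).val k p = _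
  rw [halves_of_le h]

lemma glue_val_of_ge (hp : p ∈ cube n) (h : 1 / 2 ≤ p i) (k : Fin n) :
    (glue hσ hσ').val k p = σ'.val k p :=
  val_halves_of_ge hσ hσ' hp h k

end CubeMorphism

end Gluing

section IntervalMaps

/-- Smooth maps from the unit interval to itself, the reparametrizations of a coordinate. -/
structure IsIntervalMap (f : ℝ → ℝ) : Prop where
  smooth : ContDiff ℝ ∞ f
  mapsTo : MapsTo f (Icc 0 1) (Icc 0 1)

namespace IsIntervalMap

variable {f g : ℝ → ℝ}

lemma differentiableAt (hf : IsIntervalMap f) (t : ℝ) : DifferentiableAt ℝ f t :=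
  hf.smooth.differentiable (by simp) t

lemma id : IsIntervalMap id := ⟨contDiff_id, mapsTo_id _⟩

lemma const {c : ℝ} (hc : c ∈ Icc (0 : ℝ) 1) : IsIntervalMap fun _ => c :=
  ⟨contDiff_const, fun _ _ => hc⟩

lemma one_sub : IsIntervalMap fun t => 1 - t :=
  ⟨contDiff_const.sub contDiff_id, fun _ => Icc.mem_iff_one_sub_mem.1⟩

lemma comp (hf : IsIntervalMap f) (hg : IsIntervalMap g) : IsIntervalMap (f ∘ g) :=
  ⟨hf.smooth.comp hg.smooth, hf.mapsTo.comp hg.mapsTo⟩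

end IsIntervalMap

namespace IsCutoff

variable {τ : ℝ → ℝ} (hτ : IsCutoff τ)

include hτ

lemma isIntervalMap : IsIntervalMap τ := ⟨hτ.smooth, fun t _ => hτ.mem_Icc t⟩

lemma isIntervalMap_two_mul : IsIntervalMap fun t => τ (2 * t) :=
  ⟨hτ.smooth.comp (contDiff_const.mul contDiff_id), fun _ _ => hτ.mem_Icc _⟩

lemma isIntervalMap_two_mul_sub_one : IsIntervalMap fun t => τ (2 * t - 1) :=
  ⟨hτ.smooth.comp ((contDiff_const.mul contDiff_id).sub contDiff_const), fun _ _ => hτ.mem_Icc _⟩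

lemma deriv_eq_zero_of_nonpos {t : ℝ} (ht : t ≤ 0) : deriv τ t = 0 := by
  refine IsLocalMin.deriv_eq_zero (Eventually.of_forall fun s => ?_)
  rw [hτ.eq_zero t ht]
  exact (hτ.mem_Icc s).1

lemma deriv_eq_zero_of_one_le {t : ℝ} (ht : 1 ≤ t) : deriv τ t = 0 := by
  refine IsLocalMax.deriv_eq_zero (Eventually.of_forall fun s => ?_)
  rw [hτ.eq_one t ht]
  exact (hτ.mem_Icc s).2

lemma hasDerivAt_two_mul (t : ℝ) : HasDerivAt (fun t => τ (2 * t)) (2 * deriv τ (2 * t)) t := by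
  have h2 : HasDerivAt (fun t : ℝ => 2 * t) 2 t := by simpa using (hasDerivAt_id t).const_mul 2
  rw [mul_comm]
  exact (hτ.isIntervalMap.differentiableAt _).hasDerivAt.comp t h2

lemma hasDerivAt_two_mul_sub_one (t : ℝ) :
    HasDerivAt (fun t => τ (2 * t - 1)) (2 * deriv τ (2 * t - 1)) t := by
  have h2 : HasDerivAt (fun t : ℝ => 2 * t - 1) 2 t := by
    simpa using ((hasDerivAt_id t).const_mul 2).sub_const 1
  rw [mul_comm]
  exact (hτ.isIntervalMap.differentiableAt _).hasDerivAt.comp t h2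

end IsCutoff

lemma jac_eq_deriv {m n : ℕ} {φ : (Fin m → ℝ) → (Fin n → ℝ)} {p : Fin m → ℝ}
    (hφ : DifferentiableAt ℝ φ p) (j : Fin m) (k : Fin n) :
    jac φ p j k = deriv (fun t => φ (update p j t) k) (p j) := by
  have h : HasFDerivAt φ (fderiv ℝ φ p) (update p j (p j)) := by
    rw [update_eq_self]
    exact hφ.hasFDerivAt
  exact (hasDerivAt_pi.1 (h.comp_hasDerivAt (p j) (hasDerivAt_update p j (p j))) k).deriv.symm

variable {n : ℕ}

/-- The map of the cube which applies `g` to the `i`-th coordinate. -/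
def coordMap (i : Fin n) (g : ℝ → ℝ) (p : Fin n → ℝ) : Fin n → ℝ := update p i (g (p i))

variable {i j k : Fin n} {g : ℝ → ℝ} {p : Fin n → ℝ}

lemma coordMap_self : coordMap i g p i = g (p i) := update_self _ _ _

lemma coordMap_of_ne (h : k ≠ i) : coordMap i g p k = p k := update_of_ne h _ _

lemma IsIntervalMap.contDiff_coordMap (hg : IsIntervalMap g) : ContDiff ℝ ∞ (coordMap i g) := by
  refine contDiff_pi.2 fun k => ?_
  rcases eq_or_ne k i with rfl | h
  · simp only [coordMap_self]
    exact hg.smooth.comp (contDiff_apply ℝ ℝ k)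
  · simp only [coordMap_of_ne h]
    exact contDiff_apply ℝ ℝ k

lemma update_mem_cube {c : ℝ} (hp : p ∈ cube n) (hc : c ∈ Icc (0 : ℝ) 1) :
    update p i c ∈ cube n :=
  ⟨le_update_iff.2 ⟨hc.1, fun j _ => hp.1 j⟩, update_le_iff.2 ⟨hc.2, fun j _ => hp.2 j⟩⟩

lemma IsIntervalMap.mapsTo_coordMap (hg : IsIntervalMap g) :
    MapsTo (coordMap i g) (cube n) (cube n) := fun _ hp =>
  update_mem_cube hp (hg.mapsTo ⟨hp.1 i, hp.2 i⟩)

lemma IsIntervalMap.jac_coordMap_self (hg : IsIntervalMap g) :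
    jac (coordMap i g) p i i = deriv g (p i) := by
  rw [jac_eq_deriv (hg.contDiff_coordMap.differentiable (by simp) p)]
  simp only [coordMap, update_self]

lemma IsIntervalMap.jac_coordMap_of_ne (hg : IsIntervalMap g) (h : k ≠ j) :
    jac (coordMap i g) p j k = 0 := by
  rw [jac_eq_deriv (hg.contDiff_coordMap.differentiable (by simp) p)]
  rcases eq_or_ne k i with rfl | hk
  · simp only [coordMap, update_self, update_of_ne h, deriv_const]
  · simp only [coordMap, update_of_ne h, update_of_ne hk, deriv_const]

lemma IsIntervalMap.jac_coordMap_diag (hg : IsIntervalMap g) (h : k ≠ i) :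
    jac (coordMap i g) p k k = 1 := by
  rw [jac_eq_deriv (hg.contDiff_coordMap.differentiable (by simp) p)]
  simp only [coordMap, update_self, update_of_ne h, deriv_id'']

end IntervalMaps

section Concatenation

variable {M F : Type*} {A : M → Type*} [∀ x, AddCommGroup (A x)] [∀ x, Module ℝ (A x)]

lemma scale_one (v : TotalSpace F A) : scale 1 v = v :=
  congrArg (TotalSpace.mk v.1) (one_smul ℝ v.2)

lemma scale_zero {v : TotalSpace F A} {x : M} (h : v.1 = x) : scale 0 v = ⟨x, 0⟩ := by
  subst h
  exact congrArg (TotalSpace.mk v.1) (zero_smul ℝ v.2)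

variable {E : Type*} [NormedAddCommGroup E] [NormedSpace ℝ E] [TopologicalSpace M]
  [ChartedSpace E M] [NormedAddCommGroup F] [NormedSpace ℝ F] [TopologicalSpace (TotalSpace F A)]
  [∀ x, TopologicalSpace (A x)] [FiberBundle F A] [VectorBundle ℝ F A]
  [IsManifold 𝓘(ℝ, E) ∞ M] {L : LieAlgebroid E M F A}

namespace CubeMorphism

/-- A morphism `σ : T I^n → A` is thin if `∧² σ = 0`. -/
def IsThin {n : ℕ} (σ : CubeMorphism L n) : Prop :=
  ∀ p ∈ cube n, ∀ i j, ExteriorAlgebra.ι ℝ (σ.comp i p) * ExteriorAlgebra.ι ℝ (σ.comp j p) = 0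

lemma isThin_of_dim_one (σ : CubeMorphism L 1) : σ.IsThin := fun p _ i j => by
  rw [Subsingleton.elim i j]
  exact ExteriorAlgebra.ι_sq_zero _

variable [ContMDiffVectorBundle ∞ F A 𝓘(ℝ, E)]

lemma IsThin.glue {n : ℕ} {σ σ' η : CubeMorphism L n} {i : Fin n}
    {hσ : ∀ p ∈ cube n, 1 / 2 ≤ p i → ∀ k, σ.val k p = η.val k p}
    {hσ' : ∀ p ∈ cube n, p i ≤ 1 / 2 → ∀ k, σ'.val k p = η.val k p}
    (h : σ.IsThin) (h' : σ'.IsThin) : (glue hσ hσ').IsThin := fun p hp j k => by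
  have hhalf : (halves σ σ' i p).IsThin := by
    rw [halves]
    split_ifs
    exacts [h, h']
  exact hhalf p hp j k

variable [FiniteDimensional ℝ E] [FiniteDimensional ℝ F] [T2Space M] {m n : ℕ} [NeZero n]
  (σ σ' : CubeMorphism L n)

section Pull

variable {σ} {φ : (Fin m → ℝ) → (Fin n → ℝ)} {hφ : ContDiff ℝ ∞ φ}
  {hm : MapsTo φ (cube m) (cube n)}

lemma IsThin.pull (h : σ.IsThin) : (σ.pull hφ hm).IsThin := fun p hp i j => by
  change ExteriorAlgebra.ι ℝ (∑ k, jac φ p i k • σ.comp k (φ p))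
    * ExteriorAlgebra.ι ℝ (∑ k, jac φ p j k • σ.comp k (φ p)) = 0
  rw [map_sum, map_sum, Finset.sum_mul_sum]
  refine Finset.sum_eq_zero fun k _ => Finset.sum_eq_zero fun l _ => ?_
  rw [map_smul, map_smul, smul_mul_smul_comm, h _ (hm hp), smul_zero]

lemma pull_val_eq_scale {p : Fin m → ℝ} {j : Fin m} (k : Fin n) (h : ∀ l ≠ k, jac φ p j l = 0) :
    (σ.pull hφ hm).val j p = scale (jac φ p j k) (σ.val k (φ p)) :=
  congrArg (TotalSpace.mk _) (Fintype.sum_eq_single k fun l hl =>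
    (congrArg (· • σ.comp l (φ p)) (h l hl)).trans (zero_smul ℝ _))

lemma pull_comp_eq_zero {p : Fin m → ℝ} {j : Fin m}
    (h : ∀ k, jac φ p j k = 0 ∨ σ.comp k (φ p) = 0) : (σ.pull hφ hm).comp j p = 0 := by
  change ∑ k, jac φ p j k • σ.comp k (φ p) = 0
  exact Finset.sum_eq_zero fun k _ => (h k).elim
    (fun h => (congrArg (· • σ.comp k (φ p)) h).trans (zero_smul ℝ _))
    fun h => (congrArg (jac φ p j k • ·) h).trans (smul_zero _)

end Pull

/-- The reparametrization of `σ` by `g` in the direction `i`. -/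
def reparam (i : Fin n) {g : ℝ → ℝ} (hg : IsIntervalMap g) : CubeMorphism L n :=
  σ.pull hg.contDiff_coordMap (hg.mapsTo_coordMap (i := i))

variable {σ σ'} {i k : Fin n} {f g : ℝ → ℝ} {p : Fin n → ℝ}

lemma reparam_val_self (hg : IsIntervalMap g) :
    (σ.reparam i hg).val i p = scale (deriv g (p i)) (σ.val i (coordMap i g p)) := by
  rw [← hg.jac_coordMap_self]
  exact pull_val_eq_scale i fun l hl => hg.jac_coordMap_of_ne hl

lemma reparam_val_of_ne (hg : IsIntervalMap g) (h : k ≠ i) :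
    (σ.reparam i hg).val k p = σ.val k (coordMap i g p) := by
  refine (pull_val_eq_scale k fun l hl => hg.jac_coordMap_of_ne hl).trans ?_
  rw [hg.jac_coordMap_diag h, scale_one]

lemma reparam_val_congr (hf : IsIntervalMap f) (hg : IsIntervalMap g) (h : f (p i) = g (p i))
    (h' : deriv f (p i) = deriv g (p i)) (k : Fin n) :
    (σ.reparam i hf).val k p = (σ.reparam i hg).val k p := by
  rcases eq_or_ne k i with rfl | hk
  · rw [reparam_val_self, reparam_val_self, h', coordMap, h, coordMap]
  · rw [reparam_val_of_ne hf hk, reparam_val_of_ne hg hk, coordMap, h, coordMap]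

/-- The end of `σ` in the direction `i` agrees with the beginning of `σ'`. -/
structure Composable (σ σ' : CubeMorphism L n) (i : Fin n) : Prop where
  base_eq : ∀ p ∈ cube n, σ.base (update p i 1) = σ'.base (update p i 0)
  val_eq : ∀ p ∈ cube n, ∀ k ≠ i, σ.val k (update p i 1) = σ'.val k (update p i 0)

variable {τ : ℝ → ℝ} (hτ : IsCutoff τ) (h : Composable σ σ' i)

/-- The concatenation, in the direction `i`, of the reparametrizations of `σ` and `σ'` by `τ`. On
the wrong side of the wall both are constant in the direction `i`, equal to the common face. -/
def concat : CubeMorphism L n :=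
  glue (σ := σ.reparam i hτ.isIntervalMap_two_mul)
    (σ' := σ'.reparam i hτ.isIntervalMap_two_mul_sub_one)
    (η := σ.reparam i (.const unitInterval.one_mem)) (i := i)
    (fun p _ hpi => reparam_val_congr _ _ (hτ.eq_one _ (by linarith)) (by
      rw [(hτ.hasDerivAt_two_mul _).deriv, hτ.deriv_eq_zero_of_one_le (by linarith), mul_zero,
        deriv_const]))
    fun p hp hpi k => by
      have hg : τ (2 * p i - 1) = 0 := hτ.eq_zero _ (by linarith)
      rcases eq_or_ne k i with rfl | hk
      · rw [reparam_val_self, reparam_val_self, (hτ.hasDerivAt_two_mul_sub_one _).deriv,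
          hτ.deriv_eq_zero_of_nonpos (by linarith), mul_zero, deriv_const, coordMap, hg, coordMap,
          scale_zero (h.base_eq p hp).symm, scale_zero rfl]
        rfl
      · rw [reparam_val_of_ne _ hk, reparam_val_of_ne _ hk, coordMap, hg, coordMap,
          h.val_eq p hp k hk]

lemma concat_val_of_le (hpi : p i ≤ 1 / 2) (k : Fin n) :
    (concat hτ h).val k p = (σ.reparam i hτ.isIntervalMap_two_mul).val k p :=
  glue_val_of_le _ _ hpi k

lemma concat_val_of_ge (hp : p ∈ cube n) (hpi : 1 / 2 ≤ p i) (k : Fin n) :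
    (concat hτ h).val k p = (σ'.reparam i hτ.isIntervalMap_two_mul_sub_one).val k p :=
  glue_val_of_ge _ _ hp hpi k

lemma IsThin.concat (hσ : σ.IsThin) (hσ' : σ'.IsThin) : (concat hτ h).IsThin :=
  .glue hσ.pull hσ'.pull

end CubeMorphism

end Concatenation

section Homotopies

variable {M F : Type*} {A : M → Type*} [∀ x, AddCommGroup (A x)]

lemma snd_eq_zero_of_eq {v w : TotalSpace F A} (h : v = w) (hw : w.2 = 0) : v.2 = 0 := by
  rwa [h]

variable [∀ x, Module ℝ (A x)]

lemma snd_eq_zero_of_eq_scale {v w : TotalSpace F A} {r : ℝ} (h : v = scale r w) (hw : w.2 = 0) :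
    v.2 = 0 := by
  subst h
  exact (congrArg (fun e : A w.1 => r • e) hw).trans (smul_zero r)

variable {n : ℕ}

lemma update_last_eq_snoc (p : Fin (n + 1) → ℝ) (c : ℝ) :
    update p (Fin.last n) c = Fin.snoc (Fin.init p) c := by
  conv_lhs => rw [← Fin.snoc_init_self p, Fin.update_snoc_last]

lemma init_mem_cube {p : Fin (n + 1) → ℝ} (hp : p ∈ cube (n + 1)) : Fin.init p ∈ cube n :=
  ⟨fun i => hp.1 i.castSucc, fun i => hp.2 i.castSucc⟩

lemma snoc_mem_cube {p : Fin n → ℝ} (hp : p ∈ cube n) {c : ℝ} (hc : c ∈ Icc (0 : ℝ) 1) :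
    (Fin.snoc p c : Fin (n + 1) → ℝ) ∈ cube (n + 1) := by
  have h (i : Fin (n + 1)) : (Fin.snoc p c : Fin (n + 1) → ℝ) i ∈ Icc (0 : ℝ) 1 := by
    refine Fin.lastCases ?_ (fun j => ?_) i
    · rwa [Fin.snoc_last]
    · rw [Fin.snoc_castSucc]
      exact ⟨hp.1 j, hp.2 j⟩
  exact ⟨fun i => (h i).1, fun i => (h i).2⟩

lemma coordMap_castSucc_snoc (i : Fin n) (g : ℝ → ℝ) (p : Fin n → ℝ) (c : ℝ) :
    coordMap i.castSucc g (Fin.snoc p c : Fin (n + 1) → ℝ) = Fin.snoc (coordMap i g p) c := by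
  rw [coordMap, Fin.snoc_castSucc, coordMap, Fin.snoc_update]

lemma coordMap_last_snoc (g : ℝ → ℝ) (p : Fin n → ℝ) (c : ℝ) :
    coordMap (Fin.last n) g (Fin.snoc p c : Fin (n + 1) → ℝ) = Fin.snoc p (g c) := by
  rw [coordMap, Fin.snoc_last, Fin.update_snoc_last]

lemma contDiff_init : ContDiff ℝ ∞ (Fin.init : (Fin (n + 1) → ℝ) → Fin n → ℝ) :=
  contDiff_pi.2 fun i => contDiff_apply ℝ ℝ i.castSucc

lemma jac_init (p : Fin (n + 1) → ℝ) (j : Fin (n + 1)) (k : Fin n) :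
    jac Fin.init p j k = if j = k.castSucc then 1 else 0 := by
  rw [jac_eq_deriv (contDiff_init.differentiable (by simp) p)]
  split_ifs with h
  · subst h
    simp only [Fin.init, update_self, deriv_id'']
  · simp only [Fin.init, update_of_ne (Ne.symm h), deriv_const]

variable {E : Type*} [NormedAddCommGroup E] [NormedSpace ℝ E] [TopologicalSpace M]
  [ChartedSpace E M] [NormedAddCommGroup F] [NormedSpace ℝ F] [TopologicalSpace (TotalSpace F A)]
  [∀ x, TopologicalSpace (A x)] [FiberBundle F A] [VectorBundle ℝ F A]
  [IsManifold 𝓘(ℝ, E) ∞ M] {L : LieAlgebroid E M F A}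

namespace CubeMorphism

/-- `K` restricts to `σ` on the face of `I^(n+1)` where the last coordinate is `c`. -/
def RestrictsTo (K : CubeMorphism L (n + 1)) (c : ℝ) (σ : CubeMorphism L n) : Prop :=
  ∀ p ∈ cube n, ∀ k : Fin n, K.val k.castSucc (Fin.snoc p c) = σ.val k p

/-- `K` is a homotopy from `σ₀` to `σ₁` in the last coordinate: it restricts to them at the two
ends, and its last component vanishes over the boundary of `I^n`. For `n = 1` these are the
`A`-homotopies, for `n = 2` the 3-homotopies. -/
structure IsHomotopy (K : CubeMorphism L (n + 1)) (σ₀ σ₁ : CubeMorphism L n) : Prop where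
  source : K.RestrictsTo 0 σ₀
  target : K.RestrictsTo 1 σ₁
  comp_last : ∀ p ∈ cube (n + 1), (∃ i : Fin n, p i.castSucc = 0 ∨ p i.castSucc = 1) →
    K.comp (Fin.last n) p = 0

lemma RestrictsTo.composable_last [NeZero n] {K K' : CubeMorphism L (n + 1)}
    {σ : CubeMorphism L n} (h : K.RestrictsTo 1 σ) (h' : K'.RestrictsTo 0 σ) :
    K.Composable K' (Fin.last n) := by
  have hval (p) (hp : p ∈ cube (n + 1)) (k : Fin n) :
      K.val k.castSucc (update p (Fin.last n) 1) = K'.val k.castSucc (update p (Fin.last n) 0) := by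
    rw [update_last_eq_snoc, update_last_eq_snoc, h _ (init_mem_cube hp), h' _ (init_mem_cube hp)]
  refine ⟨fun p hp => congrArg TotalSpace.proj (hval p hp 0), fun p hp k hk => ?_⟩
  obtain ⟨k, rfl⟩ := Fin.exists_castSucc_eq.2 hk
  exact hval p hp k

variable [ContMDiffVectorBundle ∞ F A 𝓘(ℝ, E)] [FiniteDimensional ℝ E] [FiniteDimensional ℝ F]
  [T2Space M]

section Const

variable [NeZero n] (σ : CubeMorphism L n)

/-- The homotopy which is constant in the last coordinate. -/
def constHomotopy : CubeMorphism L (n + 1) := σ.pull contDiff_init fun _ => init_mem_cube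

lemma isHomotopy_constHomotopy : σ.constHomotopy.IsHomotopy σ σ := by
  have hval (c : ℝ) : σ.constHomotopy.RestrictsTo c σ := fun p _ k => by
    refine (pull_val_eq_scale k fun l hl => ?_).trans ?_
    · rw [jac_init, if_neg fun h => hl (Fin.castSucc_injective n h).symm]
    · rw [jac_init, if_pos rfl, scale_one, Fin.init_snoc]
  exact ⟨hval 0, hval 1, fun p _ _ => pull_comp_eq_zero fun k =>
    .inl ((jac_init _ _ _).trans (if_neg (Fin.castSucc_ne_last k).symm))⟩

end Const

section Reparam

variable {K : CubeMorphism L (n + 1)} {σ σ₀ σ₁ : CubeMorphism L n} {c : ℝ} {g : ℝ → ℝ}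

lemma RestrictsTo.reparam_last {c' : ℝ} (hK : K.RestrictsTo c σ) (hg : IsIntervalMap g)
    (hc : g c' = c) : (K.reparam (Fin.last n) hg).RestrictsTo c' σ := fun p hp k => by
  rw [reparam_val_of_ne _ (Fin.castSucc_ne_last k), coordMap_last_snoc, hc, hK p hp]

lemma IsHomotopy.comp_last_reparam_last (hK : K.IsHomotopy σ₀ σ₁) (hg : IsIntervalMap g)
    {p : Fin (n + 1) → ℝ} (hp : p ∈ cube (n + 1))
    (h : ∃ i : Fin n, p i.castSucc = 0 ∨ p i.castSucc = 1) :
    (K.reparam (Fin.last n) hg).comp (Fin.last n) p = 0 := by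
  refine snd_eq_zero_of_eq_scale (reparam_val_self hg) (hK.comp_last _ (hg.mapsTo_coordMap hp) ?_)
  simpa only [coordMap_of_ne (Fin.castSucc_ne_last _)] using h

lemma IsHomotopy.symm (hK : K.IsHomotopy σ₀ σ₁) :
    (K.reparam (Fin.last n) .one_sub).IsHomotopy σ₁ σ₀ where
  source := hK.target.reparam_last _ (sub_zero 1)
  target := hK.source.reparam_last _ (sub_self 1)
  comp_last _ := hK.comp_last_reparam_last _

variable {i : Fin n}

lemma RestrictsTo.reparam [NeZero n] (hK : K.RestrictsTo c σ) (hg : IsIntervalMap g) :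
    (K.reparam i.castSucc hg).RestrictsTo c (σ.reparam i hg) := fun p hp k => by
  rcases eq_or_ne k i with rfl | hk
  · rw [reparam_val_self, reparam_val_self, Fin.snoc_castSucc, coordMap_castSucc_snoc,
      hK _ (hg.mapsTo_coordMap hp)]
  · rw [reparam_val_of_ne _ ((Fin.castSucc_injective n).ne hk), reparam_val_of_ne _ hk,
      coordMap_castSucc_snoc, hK _ (hg.mapsTo_coordMap hp)]

lemma IsHomotopy.comp_last_reparam (hK : K.IsHomotopy σ₀ σ₁) (hg : IsIntervalMap g)
    (h0 : g 0 = 0 ∨ g 0 = 1) (h1 : g 1 = 0 ∨ g 1 = 1) {p : Fin (n + 1) → ℝ}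
    (hp : p ∈ cube (n + 1)) (h : ∃ j : Fin n, p j.castSucc = 0 ∨ p j.castSucc = 1) :
    (K.reparam i.castSucc hg).comp (Fin.last n) p = 0 := by
  refine snd_eq_zero_of_eq (reparam_val_of_ne hg (Fin.castSucc_ne_last i).symm)
    (hK.comp_last _ (hg.mapsTo_coordMap hp) ?_)
  obtain ⟨j, hj⟩ := h
  refine ⟨j, ?_⟩
  rcases eq_or_ne j i with rfl | hji
  · rw [coordMap_self]
    rcases hj with hj | hj <;> rwa [hj]
  · rwa [coordMap_of_ne ((Fin.castSucc_injective n).ne hji)]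

lemma IsHomotopy.reparam [NeZero n] (hK : K.IsHomotopy σ₀ σ₁) (hg : IsIntervalMap g)
    (h0 : g 0 = 0 ∨ g 0 = 1) (h1 : g 1 = 0 ∨ g 1 = 1) :
    (K.reparam i.castSucc hg).IsHomotopy (σ₀.reparam i hg) (σ₁.reparam i hg) where
  source := hK.source.reparam hg
  target := hK.target.reparam hg
  comp_last _ := hK.comp_last_reparam hg h0 h1

end Reparam

section Concat

variable [NeZero n] {K K' : CubeMorphism L (n + 1)} {σ₀ σ₁ σ₂ σ₀' σ₁' : CubeMorphism L n}
  {τ : ℝ → ℝ} (hτ : IsCutoff τ)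

lemma concat_comp_eq_zero {σ σ' : CubeMorphism L n} {i k : Fin n} (h : σ.Composable σ' i)
    {p : Fin n → ℝ} (hp : p ∈ cube n)
    (hσ : (σ.reparam i hτ.isIntervalMap_two_mul).comp k p = 0)
    (hσ' : (σ'.reparam i hτ.isIntervalMap_two_mul_sub_one).comp k p = 0) :
    (concat hτ h).comp k p = 0 := by
  rcases le_total (p i) (1 / 2) with hl | hl
  · exact snd_eq_zero_of_eq (concat_val_of_le hτ h hl k) hσ
  · exact snd_eq_zero_of_eq (concat_val_of_ge hτ h hp hl k) hσ'

lemma IsHomotopy.trans (hK : K.IsHomotopy σ₀ σ₁) (hK' : K'.IsHomotopy σ₁ σ₂) :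
    (concat hτ (hK.target.composable_last hK'.source)).IsHomotopy σ₀ σ₂ where
  source p hp k := (concat_val_of_le _ _ (by rw [Fin.snoc_last]; norm_num) _).trans
    (hK.source.reparam_last hτ.isIntervalMap_two_mul (hτ.eq_zero _ (by norm_num)) p hp k)
  target p hp k := (concat_val_of_ge _ _ (snoc_mem_cube hp unitInterval.one_mem)
    (by rw [Fin.snoc_last]; norm_num) _).trans
      (hK'.target.reparam_last hτ.isIntervalMap_two_mul_sub_one (hτ.eq_one _ (by norm_num)) p hp k)
  comp_last p hp h := concat_comp_eq_zero hτ _ hp (hK.comp_last_reparam_last _ hp h)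
    (hK'.comp_last_reparam_last _ hp h)

variable {i : Fin n}

lemma RestrictsTo.concat {c : ℝ} (hc : c ∈ Icc (0 : ℝ) 1) {σ σ' : CubeMorphism L n}
    (hK : K.RestrictsTo c σ) (hK' : K'.RestrictsTo c σ') (h : K.Composable K' i.castSucc)
    (hσ : σ.Composable σ' i) : (concat hτ h).RestrictsTo c (concat hτ hσ) := fun p hp k => by
  have hi : (Fin.snoc p c : Fin (n + 1) → ℝ) i.castSucc = p i := by rw [Fin.snoc_castSucc]
  rcases le_total (p i) (1 / 2) with hl | hl
  · rw [concat_val_of_le _ _ (hi.le.trans hl), concat_val_of_le _ _ hl]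
    exact hK.reparam _ p hp k
  · rw [concat_val_of_ge _ _ (snoc_mem_cube hp hc) (hl.trans hi.ge), concat_val_of_ge _ _ hp hl]
    exact hK'.reparam _ p hp k

lemma IsHomotopy.concat (hK : K.IsHomotopy σ₀ σ₁) (hK' : K'.IsHomotopy σ₀' σ₁')
    (h : K.Composable K' i.castSucc) (h₀ : σ₀.Composable σ₀' i) (h₁ : σ₁.Composable σ₁' i) :
    (concat hτ h).IsHomotopy (concat hτ h₀) (concat hτ h₁) where
  source := hK.source.concat hτ unitInterval.zero_mem hK'.source h h₀
  target := hK.target.concat hτ unitInterval.one_mem hK'.target h h₁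
  comp_last p hp hwall := concat_comp_eq_zero hτ h hp
    (hK.comp_last_reparam hτ.isIntervalMap_two_mul (.inl (hτ.eq_zero _ (by norm_num)))
      (.inr (hτ.eq_one _ (by norm_num))) hp hwall)
    (hK'.comp_last_reparam hτ.isIntervalMap_two_mul_sub_one (.inl (hτ.eq_zero _ (by norm_num)))
      (.inr (hτ.eq_one _ (by norm_num))) hp hwall)

end Concat

end CubeMorphism

end Homotopies

section ConstantMaps

variable {E M V : Type*} [NormedAddCommGroup E] [NormedSpace ℝ E] [TopologicalSpace M]
  [ChartedSpace E M] [NormedAddCommGroup V] [NormedSpace ℝ V] {f : V → M} {s : Set V} {p q : V}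

lemma eventually_eq_of_hasMFDerivWithinAt_zero [IsManifold 𝓘(ℝ, E) ∞ M] (hs : Convex ℝ s)
    (hf : ∀ p ∈ s, HasMFDerivWithinAt 𝓘(ℝ, V) 𝓘(ℝ, E) f s p (0 : V →L[ℝ] E)) (hp : p ∈ s) :
    ∀ᶠ q in 𝓝[s] p, f p = f q := by
  let e := extChartAt 𝓘(ℝ, E) (f p)
  obtain ⟨ε, hε, hball⟩ := Metric.mem_nhdsWithin_iff.1
    ((hf p hp).continuousWithinAt.eventually (extChartAt_source_mem_nhds (I := 𝓘(ℝ, E)) (f p)))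
  have hder : ∀ q ∈ Metric.ball p ε ∩ s,
      HasFDerivWithinAt (e ∘ f) (0 : V →L[ℝ] E) (Metric.ball p ε ∩ s) q := fun q hq => by
    have hsource : f q ∈ (chartAt E (f p)).source := by
      rw [← extChartAt_source 𝓘(ℝ, E)]
      exact hball hq
    have he := ((contMDiffAt_extChartAt' (I := 𝓘(ℝ, E)) (n := ∞) hsource).mdifferentiableAt
      (by simp)).hasMFDerivAt
    refine (he.comp_hasMFDerivWithinAt q
      ((hf q hq.2).mono inter_subset_right)).hasFDerivWithinAt.congr_fderiv ?_
    exact ContinuousLinearMap.comp_zero _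
  have hpε : p ∈ Metric.ball p ε ∩ s := ⟨Metric.mem_ball_self hε, hp⟩
  filter_upwards [inter_mem (mem_nhdsWithin_of_mem_nhds (Metric.ball_mem_nhds p hε))
    self_mem_nhdsWithin] with q hq
  have hle := ((convex_ball p ε).inter hs).norm_image_sub_le_of_norm_hasFDerivWithin_le (C := 0)
    hder (fun z _ => norm_zero.le) hq hpε
  rw [zero_mul, norm_le_zero_iff, sub_eq_zero] at hle
  exact e.injOn (hball hpε) (hball hq) hle

lemma eq_of_hasMFDerivWithinAt_zero [IsManifold 𝓘(ℝ, E) ∞ M] (hs : Convex ℝ s)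
    (hf : ∀ p ∈ s, HasMFDerivWithinAt 𝓘(ℝ, V) 𝓘(ℝ, E) f s p (0 : V →L[ℝ] E)) (hp : p ∈ s)
    (hq : q ∈ s) : f p = f q :=
  hs.isPreconnected.induction₂ (fun p q => f p = f q)
    (fun _ h => eventually_eq_of_hasMFDerivWithinAt_zero hs hf h)
    (fun _ _ _ _ _ _ => Eq.trans) (fun _ _ _ _ => Eq.symm) hp hq

variable [IsManifold 𝓘(ℝ, E) ∞ M] {F : Type*} {A : M → Type*} [∀ x, AddCommGroup (A x)]
  [∀ x, Module ℝ (A x)] [NormedAddCommGroup F] [NormedSpace ℝ F] [TopologicalSpace (TotalSpace F A)]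
  [∀ x, TopologicalSpace (A x)] [FiberBundle F A] [VectorBundle ℝ F A] {L : LieAlgebroid E M F A}

lemma CubeMorphism.base_eq_of_comp_eq_zero {n : ℕ} [NeZero n] (σ : CubeMorphism L n)
    (h : ∀ p ∈ cube n, ∀ i, σ.comp i p = 0) {p q : Fin n → ℝ} (hp : p ∈ cube n) (hq : q ∈ cube n) :
    σ.base p = σ.base q := by
  refine eq_of_hasMFDerivWithinAt_zero (E := E) (convex_Icc 0 1) (fun r hr => ?_) hp hq
  have hbase := ((σ.contMDiffOn_base 0 r hr).mdifferentiableWithinAt (by simp)).hasMFDerivWithinAt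
  let D : (Fin n → ℝ) →L[ℝ] E := mfderivWithin 𝓘(ℝ, Fin n → ℝ) 𝓘(ℝ, E) σ.base (cube n) r
  have hD : D = 0 := by
    refine ContinuousLinearMap.coe_injective (LinearMap.pi_ext' fun i => LinearMap.ext_ring ?_)
    refine (σ.anchor_eq i r hr).symm.trans ?_
    rw [h r hr i]
    exact map_zero _
  rwa [show mfderivWithin 𝓘(ℝ, Fin n → ℝ) 𝓘(ℝ, E) σ.base (cube n) r = 0 from hD] at hbase

end ConstantMaps

section HomotopyRelations

lemma mem_cube_iff {n : ℕ} {p : Fin n → ℝ} : p ∈ cube n ↔ ∀ i, p i ∈ Icc (0 : ℝ) 1 :=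
  forall_and.symm

lemma vec_one_mem_cube {t : ℝ} (ht : t ∈ Icc (0 : ℝ) 1) : ![t] ∈ cube 1 :=
  mem_cube_iff.2 (Fin.forall_fin_one.2 ht)

lemma vec_two_mem_cube {t s : ℝ} (ht : t ∈ Icc (0 : ℝ) 1) (hs : s ∈ Icc (0 : ℝ) 1) :
    ![t, s] ∈ cube 2 :=
  mem_cube_iff.2 (Fin.forall_fin_two.2 ⟨ht, hs⟩)

lemma vec_three_mem_cube {t s u : ℝ} (ht : t ∈ Icc (0 : ℝ) 1) (hs : s ∈ Icc (0 : ℝ) 1)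
    (hu : u ∈ Icc (0 : ℝ) 1) : ![t, s, u] ∈ cube 3 :=
  mem_cube_iff.2 (Fin.forall_fin_succ.2 ⟨ht, Fin.forall_fin_two.2 ⟨hs, hu⟩⟩)

lemma forall_mem_cube_one {P : (Fin 1 → ℝ) → Prop} :
    (∀ p ∈ cube 1, P p) ↔ ∀ t ∈ Icc (0 : ℝ) 1, P ![t] :=
  ⟨fun h _ ht => h _ (vec_one_mem_cube ht), fun h p hp => by
    rw [← FinVec.etaExpand_eq p]
    exact h _ (mem_cube_iff.1 hp 0)⟩

lemma forall_mem_cube_two {P : (Fin 2 → ℝ) → Prop} :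
    (∀ p ∈ cube 2, P p) ↔ ∀ t ∈ Icc (0 : ℝ) 1, ∀ s ∈ Icc (0 : ℝ) 1, P ![t, s] :=
  ⟨fun h _ ht _ hs => h _ (vec_two_mem_cube ht hs), fun h p hp => by
    rw [← FinVec.etaExpand_eq p]
    exact h _ (mem_cube_iff.1 hp 0) _ (mem_cube_iff.1 hp 1)⟩

lemma forall_mem_cube_three {P : (Fin 3 → ℝ) → Prop} :
    (∀ p ∈ cube 3, P p) ↔
      ∀ t ∈ Icc (0 : ℝ) 1, ∀ s ∈ Icc (0 : ℝ) 1, ∀ u ∈ Icc (0 : ℝ) 1, P ![t, s, u] :=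
  ⟨fun h _ ht _ hs _ hu => h _ (vec_three_mem_cube ht hs hu), fun h p hp => by
    rw [← FinVec.etaExpand_eq p]
    exact h _ (mem_cube_iff.1 hp 0) _ (mem_cube_iff.1 hp 1) _ (mem_cube_iff.1 hp 2)⟩

lemma snoc_vec_one (t c : ℝ) : (Fin.snoc ![t] c : Fin 2 → ℝ) = ![t, c] :=
  (FinVec.etaExpand_eq _).symm

lemma snoc_vec_two (t s c : ℝ) : (Fin.snoc ![t, s] c : Fin 3 → ℝ) = ![t, s, c] :=
  (FinVec.etaExpand_eq _).symm

lemma isCutoff_smoothTransition : IsCutoff Real.smoothTransition where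
  smooth := Real.smoothTransition.contDiff
  mem_Icc t := ⟨Real.smoothTransition.nonneg t, Real.smoothTransition.le_one t⟩
  eq_zero _ := Real.smoothTransition.zero_of_nonpos
  eq_one _ := Real.smoothTransition.one_of_one_le

variable {E M F : Type*} {A : M → Type*} [NormedAddCommGroup E] [NormedSpace ℝ E]
  [TopologicalSpace M] [ChartedSpace E M] [IsManifold 𝓘(ℝ, E) ∞ M] [NormedAddCommGroup F]
  [NormedSpace ℝ F] [TopologicalSpace (TotalSpace F A)] [∀ x, AddCommGroup (A x)]
  [∀ x, Module ℝ (A x)] [∀ x, TopologicalSpace (A x)] [FiberBundle F A] [VectorBundle ℝ F A]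
  {L : LieAlgebroid E M F A} {x y : M}

namespace CubeMorphism

lemma restrictsTo_path_iff {K : CubeMorphism L 2} {a : CubeMorphism L 1} {c : ℝ} :
    K.RestrictsTo c a ↔ ∀ t ∈ Icc (0 : ℝ) 1, K.val 0 ![t, c] = a.val 0 ![t] := by
  simp only [RestrictsTo, forall_mem_cube_one, snoc_vec_one, Fin.forall_fin_one,
    Fin.castSucc_zero]

lemma isHomotopy_path_iff {K : CubeMorphism L 2} {a₀ a₁ : CubeMorphism L 1} :
    K.IsHomotopy a₀ a₁ ↔ (∀ t ∈ Icc (0 : ℝ) 1, K.val 0 ![t, 0] = a₀.val 0 ![t]) ∧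
      (∀ t ∈ Icc (0 : ℝ) 1, K.val 0 ![t, 1] = a₁.val 0 ![t]) ∧
      (∀ s ∈ Icc (0 : ℝ) 1, K.comp 1 ![0, s] = 0) ∧
      ∀ s ∈ Icc (0 : ℝ) 1, K.comp 1 ![1, s] = 0 := by
  rw [← restrictsTo_path_iff, ← restrictsTo_path_iff]
  refine ⟨fun h => ⟨h.source, h.target, fun s hs => ?_, fun s hs => ?_⟩,
    fun ⟨h0, h1, h2, h3⟩ => ⟨h0, h1, forall_mem_cube_two.2 ?_⟩⟩
  · exact h.comp_last _ (vec_two_mem_cube unitInterval.zero_mem hs) ⟨0, .inl rfl⟩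
  · exact h.comp_last _ (vec_two_mem_cube unitInterval.one_mem hs) ⟨0, .inr rfl⟩
  · rintro t - s hs ⟨i, hi⟩
    obtain rfl := Subsingleton.elim i 0
    rcases hi with rfl | rfl
    exacts [h2 s hs, h3 s hs]

lemma restrictsTo_square_iff {K : CubeMorphism L 3} {σ : CubeMorphism L 2} {c : ℝ} :
    K.RestrictsTo c σ ↔ ∀ t ∈ Icc (0 : ℝ) 1, ∀ s ∈ Icc (0 : ℝ) 1,
      K.val 0 ![t, s, c] = σ.val 0 ![t, s] ∧ K.val 1 ![t, s, c] = σ.val 1 ![t, s] := by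
  simp only [RestrictsTo, forall_mem_cube_two, snoc_vec_two, Fin.forall_fin_two,
    Fin.castSucc_zero, Fin.castSucc_one]

lemma isHomotopy_square_iff {K : CubeMorphism L 3} {σ₀ σ₁ : CubeMorphism L 2} :
    K.IsHomotopy σ₀ σ₁ ↔
      (∀ s ∈ Icc (0 : ℝ) 1, ∀ u ∈ Icc (0 : ℝ) 1,
        K.comp 2 ![0, s, u] = 0 ∧ K.comp 2 ![1, s, u] = 0) ∧
      (∀ t ∈ Icc (0 : ℝ) 1, ∀ u ∈ Icc (0 : ℝ) 1,
        K.comp 2 ![t, 0, u] = 0 ∧ K.comp 2 ![t, 1, u] = 0) ∧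
      K.RestrictsTo 0 σ₀ ∧ K.RestrictsTo 1 σ₁ := by
  have h01 : (0 : ℝ) ∈ Icc (0 : ℝ) 1 ∧ (1 : ℝ) ∈ Icc (0 : ℝ) 1 :=
    ⟨unitInterval.zero_mem, unitInterval.one_mem⟩
  refine ⟨fun h => ⟨fun s hs u hu => ⟨?_, ?_⟩, fun t ht u hu => ⟨?_, ?_⟩, h.source, h.target⟩,
    fun ⟨h0, h1, h2, h3⟩ => ⟨h2, h3, forall_mem_cube_three.2 ?_⟩⟩
  · exact h.comp_last _ (vec_three_mem_cube h01.1 hs hu) ⟨0, .inl rfl⟩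
  · exact h.comp_last _ (vec_three_mem_cube h01.2 hs hu) ⟨0, .inr rfl⟩
  · exact h.comp_last _ (vec_three_mem_cube ht h01.1 hu) ⟨1, .inl rfl⟩
  · exact h.comp_last _ (vec_three_mem_cube ht h01.2 hu) ⟨1, .inr rfl⟩
  · rintro t ht s hs u hu ⟨i, hi⟩
    fin_cases i <;> rcases hi with rfl | rfl
    exacts [(h0 s hs u hu).1, (h0 s hs u hu).2, (h1 t ht u hu).1, (h1 t ht u hu).2]

lemma isThin_square_iff {K : CubeMorphism L 2} : K.IsThin ↔ ∀ p ∈ cube 2,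
    ExteriorAlgebra.ι ℝ (K.comp 0 p) * ExteriorAlgebra.ι ℝ (K.comp 1 p) = 0 := by
  refine ⟨fun h p hp => h p hp 0 1, fun h p hp i j => ?_⟩
  have hswap := ExteriorAlgebra.ι_add_mul_swap (R := ℝ) (K.comp 1 p) (K.comp 0 p)
  rw [h p hp, add_zero] at hswap
  fin_cases i <;> fin_cases j
  exacts [ExteriorAlgebra.ι_sq_zero _, h p hp, hswap, ExteriorAlgebra.ι_sq_zero _]

end CubeMorphism

lemma aHomotopic_iff {a₀ a₁ : APath L x y} : AHomotopic L a₀ a₁ ↔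
    ∃ K : CubeMorphism L 2, K.IsHomotopy a₀.toCubeMorphism a₁.toCubeMorphism := by
  simp only [CubeMorphism.isHomotopy_path_iff]
  exact ⟨fun ⟨σ⟩ => ⟨σ.toCubeMorphism, σ.source_eq, σ.target_eq, σ.b_zero, σ.b_one⟩,
    fun ⟨K, h0, h1, h2, h3⟩ => ⟨⟨K, h0, h1, h2, h3⟩⟩⟩

lemma thinHomotopic_iff {a₀ a₁ : APath L x y} : ThinHomotopic L a₀ a₁ ↔
    ∃ K : CubeMorphism L 2, K.IsHomotopy a₀.toCubeMorphism a₁.toCubeMorphism ∧ K.IsThin := by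
  simp only [CubeMorphism.isHomotopy_path_iff, CubeMorphism.isThin_square_iff]
  exact ⟨fun ⟨σ, h⟩ => ⟨σ.toCubeMorphism, ⟨σ.source_eq, σ.target_eq, σ.b_zero, σ.b_one⟩, h⟩,
    fun ⟨K, ⟨h0, h1, h2, h3⟩, h⟩ => ⟨⟨K, h0, h1, h2, h3⟩, h⟩⟩

lemma threeHomotopic_iff {σ₀ σ₁ : TotalAHomotopy L x y} : ThreeHomotopic L σ₀ σ₁ ↔
    ∃ K : CubeMorphism L 3, K.IsHomotopy σ₀.hom.toCubeMorphism σ₁.hom.toCubeMorphism := by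
  simp only [ThreeHomotopic, CubeMorphism.isHomotopy_square_iff,
    CubeMorphism.restrictsTo_square_iff]

lemma ThinHomotopic.aHomotopic {a₀ a₁ : APath L x y} (h : ThinHomotopic L a₀ a₁) :
    AHomotopic L a₀ a₁ := ⟨h.choose⟩

variable [ContMDiffVectorBundle ∞ F A 𝓘(ℝ, E)] [FiniteDimensional ℝ E] [FiniteDimensional ℝ F]
  [T2Space M]

variable (L x y)

lemma aHomotopic_equivalence : Equivalence (AHomotopic L (x := x) (y := y)) where
  refl a := aHomotopic_iff.2 ⟨_, a.isHomotopy_constHomotopy⟩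
  symm h := by
    obtain ⟨K, hK⟩ := aHomotopic_iff.1 h
    exact aHomotopic_iff.2 ⟨_, hK.symm⟩
  trans h h' := by
    obtain ⟨K, hK⟩ := aHomotopic_iff.1 h
    obtain ⟨K', hK'⟩ := aHomotopic_iff.1 h'
    exact aHomotopic_iff.2 ⟨_, hK.trans isCutoff_smoothTransition hK'⟩

lemma thinHomotopic_equivalence : Equivalence (ThinHomotopic L (x := x) (y := y)) where
  refl a := thinHomotopic_iff.2 ⟨_, a.isHomotopy_constHomotopy, a.isThin_of_dim_one.pull⟩
  symm h := by
    obtain ⟨K, hK, hthin⟩ := thinHomotopic_iff.1 h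
    exact thinHomotopic_iff.2 ⟨_, hK.symm, hthin.pull⟩
  trans h h' := by
    obtain ⟨K, hK, hthin⟩ := thinHomotopic_iff.1 h
    obtain ⟨K', hK', hthin'⟩ := thinHomotopic_iff.1 h'
    exact thinHomotopic_iff.2
      ⟨_, hK.trans isCutoff_smoothTransition hK', hthin.concat _ _ hthin'⟩

lemma threeHomotopic_equivalence : Equivalence (ThreeHomotopic L (x := x) (y := y)) where
  refl σ := threeHomotopic_iff.2 ⟨_, σ.hom.isHomotopy_constHomotopy⟩
  symm h := by
    obtain ⟨K, hK⟩ := threeHomotopic_iff.1 h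
    exact threeHomotopic_iff.2 ⟨_, hK.symm⟩
  trans h h' := by
    obtain ⟨K, hK⟩ := threeHomotopic_iff.1 h
    obtain ⟨K', hK'⟩ := threeHomotopic_iff.1 h'
    exact threeHomotopic_iff.2 ⟨_, hK.trans isCutoff_smoothTransition hK'⟩

end HomotopyRelations

section Paths

lemma update_fin_one (p : Fin 1 → ℝ) (c : ℝ) : update p 0 c = ![c] := by
  rw [← FinVec.etaExpand_eq (update p 0 c)]
  exact congrArg (fun r => ![r]) (update_self ..)

lemma update_zero_fin_two (p : Fin 2 → ℝ) (c : ℝ) : update p 0 c = ![c, p 1] := by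
  rw [← FinVec.etaExpand_eq (update p 0 c)]
  exact congrArg (fun r => ![r, p 1]) (update_self ..)

lemma coordMap_vec_one (f : ℝ → ℝ) (t : ℝ) : coordMap 0 f ![t] = ![f t] := update_fin_one _ _

lemma scale_scale {M F : Type*} {A : M → Type*} [∀ x, AddCommGroup (A x)] [∀ x, Module ℝ (A x)]
    (r s : ℝ) (v : TotalSpace F A) : scale r (scale s v) = scale (r * s) v :=
  congrArg (TotalSpace.mk v.1) (smul_smul r s v.2)

variable {E M F : Type*} {A : M → Type*} [NormedAddCommGroup E] [NormedSpace ℝ E]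
  [TopologicalSpace M] [ChartedSpace E M] [IsManifold 𝓘(ℝ, E) ∞ M] [NormedAddCommGroup F]
  [NormedSpace ℝ F] [TopologicalSpace (TotalSpace F A)] [∀ x, AddCommGroup (A x)]
  [∀ x, Module ℝ (A x)] [∀ x, TopologicalSpace (A x)] [FiberBundle F A] [VectorBundle ℝ F A]
  {L : LieAlgebroid E M F A} {x y z : M}

lemma APath.composable (a : APath L x y) (b : APath L y z) :
    a.Composable b.toCubeMorphism 0 where
  base_eq p _ := by rw [update_fin_one, update_fin_one, a.base_one, b.base_zero]
  val_eq _ _ k hk := (hk (Subsingleton.elim k 0)).elim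

variable [ContMDiffVectorBundle ∞ F A 𝓘(ℝ, E)] [FiniteDimensional ℝ E] [FiniteDimensional ℝ F]
  [T2Space M]

namespace CubeMorphism.IsHomotopy

variable {K K' : CubeMorphism L 2}

lemma val_one_eq {σ₀ σ₁ : CubeMorphism L 1} (hK : K.IsHomotopy σ₀ σ₁) {c : ℝ}
    (hc : c = 0 ∨ c = 1) {s : ℝ} (hs : s ∈ Icc (0 : ℝ) 1) :
    K.val 1 ![c, s] = ⟨σ₀.base ![c], 0⟩ := by
  have hcI : c ∈ Icc (0 : ℝ) 1 := by rcases hc with rfl | rfl <;> simp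
  have hzero (u : ℝ) (hu : u ∈ Icc (0 : ℝ) 1) : K.comp 1 ![c, u] = 0 :=
    hK.comp_last _ (vec_two_mem_cube hcI hu) ⟨0, hc⟩
  let φ (p : Fin 1 → ℝ) : Fin 2 → ℝ := ![c, p 0]
  have hφ : ContDiff ℝ ∞ φ :=
    contDiff_pi.2 (Fin.forall_fin_two.2 ⟨contDiff_const, contDiff_apply ℝ ℝ 0⟩)
  have hφmaps : MapsTo φ (cube 1) (cube 2) := fun p hp => vec_two_mem_cube hcI (mem_cube_iff.1 hp 0)
  have hjac (p : Fin 1 → ℝ) (j : Fin 1) : jac φ p j 0 = 0 :=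
    (jac_eq_deriv (hφ.differentiable (by simp) p) j 0).trans (deriv_const _ c)
  have hbase : K.base ![c, s] = K.base ![c, 0] :=
    (K.pull hφ hφmaps).base_eq_of_comp_eq_zero
      (fun p hp j => CubeMorphism.pull_comp_eq_zero
        (Fin.forall_fin_two.2 ⟨.inl (hjac p j), .inr (hzero _ (mem_cube_iff.1 hp 0))⟩))
      (vec_one_mem_cube hs) (vec_one_mem_cube unitInterval.zero_mem)
  have hsource : K.base ![c, 0] = σ₀.base ![c] := by
    rw [← snoc_vec_one]
    exact congrArg TotalSpace.proj (hK.source _ (vec_one_mem_cube hcI) 0)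
  rw [← hsource, ← hbase]
  exact congrArg (TotalSpace.mk _) (hzero s hs)

lemma composable {a₀ a₁ : APath L x y} {b₀ b₁ : APath L y z}
    (hK : K.IsHomotopy a₀.toCubeMorphism a₁.toCubeMorphism)
    (hK' : K'.IsHomotopy b₀.toCubeMorphism b₁.toCubeMorphism) : K.Composable K' 0 := by
  have hval (p : Fin 2 → ℝ) (hp : p ∈ cube 2) :
      K.val 1 (update p 0 1) = K'.val 1 (update p 0 0) := by
    have hp1 := mem_cube_iff.1 hp 1
    rw [update_zero_fin_two, update_zero_fin_two, hK.val_one_eq (.inr rfl) hp1,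
      hK'.val_one_eq (.inl rfl) hp1, a₀.base_one, b₀.base_zero]
  refine ⟨fun p hp => congrArg TotalSpace.proj (hval p hp), fun p hp k hk => ?_⟩
  rw [Fin.eq_one_of_ne_zero k hk]
  exact hval p hp

end CubeMorphism.IsHomotopy

namespace APath

variable {f τ : ℝ → ℝ}

/-- The pullback `f'(t) q(f(t)) dt` of the `A`-path `q` along a smooth map `f : I → I`. -/
def reparam (q : APath L x y) (hf : IsIntervalMap f) {x' y' : M} (h0 : q.base ![f 0] = x')
    (h1 : q.base ![f 1] = y') : APath L x' y' where
  toCubeMorphism := q.toCubeMorphism.reparam 0 hf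
  base_zero := by rw [← h0, ← coordMap_vec_one f 0]; rfl
  base_one := by rw [← h1, ← coordMap_vec_one f 1]; rfl

lemma at_reparam (q : APath L x y) (hf : IsIntervalMap f) {x' y' : M} (h0 : q.base ![f 0] = x')
    (h1 : q.base ![f 1] = y') (t : ℝ) :
    (q.reparam hf h0 h1).at t = scale (deriv f t) (q.at (f t)) := by
  refine (CubeMorphism.reparam_val_self hf).trans ?_
  rw [coordMap_vec_one]
  rfl

/-- The inverse path `-a(1 - t) dt`. -/
def inverse (a : APath L x y) : APath L y x :=
  a.reparam .one_sub (by rw [sub_zero, a.base_one]) (by rw [sub_self, a.base_zero])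

lemma isInverse_inverse (a : APath L x y) : IsInverse a a.inverse := fun t _ => by
  rw [inverse, at_reparam, deriv_const_sub, deriv_id'']

section Cat

variable (hτ : IsCutoff τ) (a : APath L x y) (b : APath L y z)

/-- The concatenation of the reparametrizations of `a` and `b` by `τ`. -/
def cat : APath L x z where
  toCubeMorphism := CubeMorphism.concat hτ (a.composable b)
  base_zero := by
    refine (congrArg TotalSpace.proj (CubeMorphism.concat_val_of_le hτ (a.composable b)
      (p := ![0]) (by simp) 0)).trans ?_
    change a.base (coordMap 0 _ ![0]) = x
    rw [coordMap_vec_one, hτ.eq_zero _ (by norm_num), a.base_zero]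
  base_one := by
    refine (congrArg TotalSpace.proj (CubeMorphism.concat_val_of_ge hτ (a.composable b)
      (p := ![1]) (vec_one_mem_cube unitInterval.one_mem) (by norm_num) 0)).trans ?_
    change b.base (coordMap 0 _ ![1]) = z
    rw [coordMap_vec_one, hτ.eq_one _ (by norm_num), b.base_one]

variable {t : ℝ}

lemma at_cat_of_le (ht : t ≤ 1 / 2) :
    (cat hτ a b).at t = scale (2 * deriv τ (2 * t)) (a.at (τ (2 * t))) := by
  refine (CubeMorphism.concat_val_of_le hτ (a.composable b) (p := ![t]) ht 0).trans ?_
  rw [CubeMorphism.reparam_val_self, coordMap_vec_one, (hτ.hasDerivAt_two_mul _).deriv]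
  rfl

lemma at_cat_of_ge (ht : t ∈ Icc (1 / 2 : ℝ) 1) :
    (cat hτ a b).at t = scale (2 * deriv τ (2 * t - 1)) (b.at (τ (2 * t - 1))) := by
  have hp : ![t] ∈ cube 1 := vec_one_mem_cube ⟨by linarith [ht.1], ht.2⟩
  refine (CubeMorphism.concat_val_of_ge hτ (a.composable b) hp ht.1 0).trans ?_
  rw [CubeMorphism.reparam_val_self, coordMap_vec_one, (hτ.hasDerivAt_two_mul_sub_one _).deriv]
  rfl

end Cat

end APath

section Congruence

variable {τ : ℝ → ℝ} (hτ : IsCutoff τ) {a₀ a₁ : APath L x y} {b₀ b₁ : APath L y z}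

lemma AHomotopic.cat (ha : AHomotopic L a₀ a₁) (hb : AHomotopic L b₀ b₁) :
    AHomotopic L (a₀.cat hτ b₀) (a₁.cat hτ b₁) := by
  obtain ⟨K, hK⟩ := aHomotopic_iff.1 ha
  obtain ⟨K', hK'⟩ := aHomotopic_iff.1 hb
  exact aHomotopic_iff.2 ⟨_, hK.concat (i := 0) hτ hK' (hK.composable hK')
    (a₀.composable b₀) (a₁.composable b₁)⟩

lemma ThinHomotopic.cat (ha : ThinHomotopic L a₀ a₁) (hb : ThinHomotopic L b₀ b₁) :
    ThinHomotopic L (a₀.cat hτ b₀) (a₁.cat hτ b₁) := by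
  obtain ⟨K, hK, hthin⟩ := thinHomotopic_iff.1 ha
  obtain ⟨K', hK', hthin'⟩ := thinHomotopic_iff.1 hb
  exact thinHomotopic_iff.2
    ⟨_, hK.concat (i := 0) hτ hK' (hK.composable hK')
    (a₀.composable b₀) (a₁.composable b₁), hthin.concat _ _ hthin'⟩

lemma AHomotopic.inverse (h : AHomotopic L a₀ a₁) : AHomotopic L a₀.inverse a₁.inverse := by
  obtain ⟨K, hK⟩ := aHomotopic_iff.1 h
  exact aHomotopic_iff.2 ⟨_, hK.reparam .one_sub (.inr (sub_zero 1)) (.inl (sub_self 1))⟩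

lemma ThinHomotopic.inverse (h : ThinHomotopic L a₀ a₁) :
    ThinHomotopic L a₀.inverse a₁.inverse := by
  obtain ⟨K, hK, hthin⟩ := thinHomotopic_iff.1 h
  exact thinHomotopic_iff.2
    ⟨_, hK.reparam .one_sub (.inr (sub_zero 1)) (.inl (sub_self 1)), hthin.pull⟩

end Congruence

end Paths

section Segments

variable {E M F : Type*} {A : M → Type*} [NormedAddCommGroup E] [NormedSpace ℝ E]
  [TopologicalSpace M] [ChartedSpace E M] [IsManifold 𝓘(ℝ, E) ∞ M] [NormedAddCommGroup F]
  [NormedSpace ℝ F] [TopologicalSpace (TotalSpace F A)] [∀ x, AddCommGroup (A x)]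
  [∀ x, Module ℝ (A x)] [∀ x, TopologicalSpace (A x)] [FiberBundle F A] [VectorBundle ℝ F A]
  {L : LieAlgebroid E M F A} {v w x y z : M} {r s u : ℝ} {τ : ℝ → ℝ}

/-- The `A`-path `a` traverses the part of the `A`-path `q` between the times `r` and `s`: it is the
pullback of `q` along some smooth map `f : I → I` from `r` to `s`. The map `f` is not required to be
monotone, and `s < r` is allowed. -/
def IsSegment (q : APath L x y) (r s : ℝ) (a : APath L v w) : Prop :=
  ∃ f, IsIntervalMap f ∧ f 0 = r ∧ f 1 = s ∧
    ∀ t ∈ Icc (0 : ℝ) 1, a.at t = scale (deriv f t) (q.at (f t))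

/-- The unit path `0_x dt`. -/
def APath.unit (L : LieAlgebroid E M F A) (x : M) : APath L x x where
  base _ := x
  comp _ _ := 0
  smooth _ := contMDiffOn_const
  anchor_eq i p _ := by
    rw [mfderivWithin_const]
    exact map_zero (L.anchor x : A x →L[ℝ] E)
  d_eq i j hij := (hij.ne (Subsingleton.elim i j)).elim
  base_zero := rfl
  base_one := rfl

lemma isUnitPath_unit : IsUnitPath (APath.unit L x) := fun _ _ => rfl

lemma isSegment_refl (q : APath L x y) : IsSegment q 0 1 q :=
  ⟨id, .id, rfl, rfl, fun t _ => by rw [deriv_id, scale_one]; rfl⟩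

lemma isSegment_unit (q : APath L x y) (hr : r ∈ Icc (0 : ℝ) 1) (h : q.base ![r] = z) :
    IsSegment q r r (APath.unit L z) :=
  ⟨fun _ => r, .const hr, rfl, rfl, fun t _ => by rw [deriv_const, scale_zero h]; rfl⟩

lemma IsInverse.isSegment {a : APath L x y} {b : APath L y x} (h : IsInverse a b) :
    IsSegment a 1 0 b :=
  ⟨fun t => 1 - t, .one_sub, sub_zero 1, sub_self 1, fun t ht => by
    rw [deriv_const_sub, deriv_id'', h t ht]⟩

lemma IsConcat.isSegment_left {a : APath L x y} {b : APath L y z} {c : APath L x z}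
    (h : IsConcat a b c) {d : APath L v w} (hd : IsSegment a r s d) :
    IsSegment c (r / 2) (s / 2) d := by
  obtain ⟨f, hf, rfl, rfl, hd⟩ := hd
  refine ⟨fun t => f t / 2, ⟨hf.smooth.div_const 2, fun t ht => ?_⟩, rfl, rfl, fun t ht => ?_⟩
  · have := hf.mapsTo ht
    constructor <;> linarith [this.1, this.2]
  · have hft := hf.mapsTo ht
    rw [h.1 (f t / 2) (by constructor <;> linarith [hft.1, hft.2]), scale_scale, deriv_div_const,
      div_mul_cancel₀ _ two_ne_zero, mul_div_cancel₀ _ two_ne_zero, hd t ht]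

lemma IsConcat.isSegment_right {a : APath L x y} {b : APath L y z} {c : APath L x z}
    (h : IsConcat a b c) {d : APath L v w} (hd : IsSegment b r s d) :
    IsSegment c ((r + 1) / 2) ((s + 1) / 2) d := by
  obtain ⟨f, hf, rfl, rfl, hd⟩ := hd
  refine ⟨fun t => (f t + 1) / 2, ⟨(hf.smooth.add contDiff_const).div_const 2, fun t ht => ?_⟩,
    rfl, rfl, fun t ht => ?_⟩
  · have := hf.mapsTo ht
    constructor <;> linarith [this.1, this.2]
  · have hft := hf.mapsTo ht
    rw [h.2 ((f t + 1) / 2) (by constructor <;> linarith [hft.1, hft.2]), scale_scale,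
      deriv_div_const, deriv_add_const, div_mul_cancel₀ _ two_ne_zero,
      mul_div_cancel₀ _ two_ne_zero, add_sub_cancel_right, hd t ht]

lemma IsConcat.isSegment_first {a : APath L x y} {b : APath L y z} {c : APath L x z}
    (h : IsConcat a b c) : IsSegment c 0 (1 / 2) a := by
  simpa only [zero_div] using h.isSegment_left (isSegment_refl a)

lemma IsConcat.isSegment_second {a : APath L x y} {b : APath L y z} {c : APath L x z}
    (h : IsConcat a b c) : IsSegment c (1 / 2) 1 b := by
  simpa only [zero_add, one_add_one_eq_two, div_self (two_ne_zero (α := ℝ))] using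
    h.isSegment_right (isSegment_refl b)

lemma IsConcat.base_half {a : APath L x y} {b : APath L y z} {c : APath L x z}
    (h : IsConcat a b c) : c.base ![1 / 2] = y := by
  have hc : c.base ![1 / 2] = a.base ![2 * (1 / 2)] :=
    congrArg TotalSpace.proj (h.1 (1 / 2) (by norm_num))
  rw [hc, mul_one_div_cancel two_ne_zero, a.base_one]

variable [ContMDiffVectorBundle ∞ F A 𝓘(ℝ, E)] [FiniteDimensional ℝ E] [FiniteDimensional ℝ F]
  [T2Space M]

lemma exists_isSegment (q : APath L x y) (hr : r ∈ Icc (0 : ℝ) 1) (hs : s ∈ Icc (0 : ℝ) 1)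
    (h0 : q.base ![r] = v) (h1 : q.base ![s] = w) : ∃ a : APath L v w, IsSegment q r s a := by
  let f (t : ℝ) : ℝ := r + t * (s - r)
  have hf : IsIntervalMap f := ⟨contDiff_const.add (contDiff_id.mul contDiff_const), fun t ht =>
    (convex_Icc 0 1).add_smul_sub_mem hr hs ht⟩
  have hf0 : f 0 = r := by ring
  have hf1 : f 1 = s := by ring
  exact ⟨q.reparam hf (by rw [hf0, h0]) (by rw [hf1, h1]), f, hf, hf0, hf1, fun t _ =>
    q.at_reparam hf _ _ t⟩

lemma IsSegment.of_reparam {f : ℝ → ℝ} {q : APath L x y} (hf : IsIntervalMap f) {x' y' : M}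
    {h0 : q.base ![f 0] = x'} {h1 : q.base ![f 1] = y'} {a : APath L v w}
    (ha : IsSegment (q.reparam hf h0 h1) r s a) : IsSegment q (f r) (f s) a := by
  obtain ⟨g, hg, rfl, rfl, ha⟩ := ha
  refine ⟨f ∘ g, hf.comp hg, rfl, rfl, fun t ht => ?_⟩
  rw [ha t ht, APath.at_reparam, scale_scale,
    deriv_comp t (hf.differentiableAt _) (hg.differentiableAt t), mul_comm]
  rfl

-- The affine homotopy between the two interval maps pulls `q` back to a thin homotopy.
lemma IsSegment.thinHomotopic {q : APath L v w} {a b : APath L x y} (ha : IsSegment q r s a)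
    (hb : IsSegment q r s b) : ThinHomotopic L a b := by
  obtain ⟨f, hf, hf0, hf1, ha⟩ := ha
  obtain ⟨g, hg, hg0, hg1, hb⟩ := hb
  let h (s t : ℝ) : ℝ := f t + s * (g t - f t)
  let φ (p : Fin 2 → ℝ) : Fin 1 → ℝ := ![h (p 1) (p 0)]
  have hf' := hf.smooth.comp (contDiff_apply ℝ ℝ (0 : Fin 2))
  have hg' := hg.smooth.comp (contDiff_apply ℝ ℝ (0 : Fin 2))
  have hφ : ContDiff ℝ ∞ φ := contDiff_pi.2 <| Fin.forall_fin_one.2 <|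
    hf'.add ((contDiff_apply ℝ ℝ 1).mul (hg'.sub hf'))
  have hm : MapsTo φ (cube 2) (cube 1) := fun p hp => vec_one_mem_cube <|
    (convex_Icc 0 1).add_smul_sub_mem (hf.mapsTo (mem_cube_iff.1 hp 0))
      (hg.mapsTo (mem_cube_iff.1 hp 0)) (mem_cube_iff.1 hp 1)
  have hval (t s : ℝ) : (q.pull hφ hm).val 0 ![t, s] = scale (deriv (h s) t) (q.at (h s t)) := by
    refine (CubeMorphism.pull_val_eq_scale 0 fun l hl => (hl (Subsingleton.elim l 0)).elim).trans ?_
    rw [jac_eq_deriv (hφ.differentiable (by simp) _)]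
    rfl
  have hcomp {c : ℝ} (hc : f c = g c) (s : ℝ) : (q.pull hφ hm).comp 1 ![c, s] = 0 := by
    refine CubeMorphism.pull_comp_eq_zero (Fin.forall_fin_one.2 (.inl ?_))
    rw [jac_eq_deriv (hφ.differentiable (by simp) _)]
    change deriv (fun s => h s c) s = 0
    simp only [h, hc, sub_self, mul_zero, add_zero, deriv_const]
  have h0 : h 0 = f := funext fun t => by ring
  have h1 : h 1 = g := funext fun t => by ring
  refine thinHomotopic_iff.2 ⟨q.pull hφ hm, CubeMorphism.isHomotopy_path_iff.2
    ⟨fun t ht => ?_, fun t ht => ?_, fun s _ => hcomp (hf0.trans hg0.symm) s,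
      fun s _ => hcomp (hf1.trans hg1.symm) s⟩, q.isThin_of_dim_one.pull⟩
  · rw [hval, h0]
    exact (ha t ht).symm
  · rw [hval, h1]
    exact (hb t ht).symm

section Cat

variable (hτ : IsCutoff τ)

/-- The reparametrization `τ'(t) a(τ(t)) dt` of `a` by a cut-off function. -/
def APath.cutoff (a : APath L x y) : APath L x y :=
  a.reparam hτ.isIntervalMap (by rw [hτ.eq_zero 0 le_rfl, a.base_zero])
    (by rw [hτ.eq_one 1 le_rfl, a.base_one])

lemma isReparam_cutoff (a : APath L x y) : IsReparam τ a (a.cutoff hτ) := fun t _ =>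
  a.at_reparam _ _ _ t

lemma IsSegment.of_cutoff {q : APath L x y} {a : APath L v w}
    (ha : IsSegment (q.cutoff hτ) r s a) : IsSegment q (τ r) (τ s) a :=
  ha.of_reparam hτ.isIntervalMap

lemma thinHomotopic_cutoff (a : APath L x y) : ThinHomotopic L (a.cutoff hτ) a := by
  have h := (isSegment_refl (a.cutoff hτ)).of_cutoff hτ
  rw [hτ.eq_zero 0 le_rfl, hτ.eq_one 1 le_rfl] at h
  exact h.thinHomotopic (isSegment_refl a)

lemma isConcat_cat (a : APath L x y) (b : APath L y z) :
    IsConcat (a.cutoff hτ) (b.cutoff hτ) (a.cat hτ b) := by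
  refine ⟨fun t ht => ?_, fun t ht => ?_⟩
  · rw [a.at_cat_of_le hτ b ht.2, APath.cutoff, APath.at_reparam, scale_scale]
  · rw [a.at_cat_of_ge hτ b ht, APath.cutoff, APath.at_reparam, scale_scale]

lemma IsSegment.cat {q : APath L v w} {a : APath L x y} {b : APath L y z} (ha : IsSegment q r s a)
    (hb : IsSegment q s u b) : IsSegment q r u (a.cat hτ b) := by
  obtain ⟨f, hf, rfl, rfl, ha⟩ := ha
  obtain ⟨g, hg, hg0, rfl, hb⟩ := hb
  let k (t : ℝ) : ℝ := f (τ (2 * t)) + (g (τ (2 * t - 1)) - f 1)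
  have hle {t : ℝ} (ht : t ≤ 1 / 2) : k t = f (τ (2 * t)) := by
    simp only [k, hτ.eq_zero (2 * t - 1) (by linarith), hg0, sub_self, add_zero]
  have hge {t : ℝ} (ht : 1 / 2 ≤ t) : k t = g (τ (2 * t - 1)) := by
    simp only [k, hτ.eq_one (2 * t) (by linarith), add_sub_cancel]
  have hk (t : ℝ) : deriv k t = deriv f (τ (2 * t)) * (2 * deriv τ (2 * t))
      + deriv g (τ (2 * t - 1)) * (2 * deriv τ (2 * t - 1)) :=
    (((hf.differentiableAt _).hasDerivAt.comp t (hτ.hasDerivAt_two_mul t)).add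
      (((hg.differentiableAt _).hasDerivAt.comp t (hτ.hasDerivAt_two_mul_sub_one t)).sub_const
        _)).deriv
  have hsmooth : ContDiff ℝ ∞ k := (hf.smooth.comp hτ.isIntervalMap_two_mul.smooth).add
    ((hg.smooth.comp hτ.isIntervalMap_two_mul_sub_one.smooth).sub contDiff_const)
  refine ⟨k, ⟨hsmooth, fun t _ => ?_⟩, ?_, ?_, fun t ht => ?_⟩
  · rcases le_total t (1 / 2) with h | h
    · exact hle h ▸ hf.mapsTo (hτ.mem_Icc _)
    · exact hge h ▸ hg.mapsTo (hτ.mem_Icc _)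
  · rw [hle (by norm_num), hτ.eq_zero _ (by norm_num)]
  · rw [hge (by norm_num), hτ.eq_one _ (by norm_num)]
  · rcases le_total t (1 / 2) with h | h
    · rw [a.at_cat_of_le hτ b h, ha _ (hτ.mem_Icc _), scale_scale, hk, hle h,
        hτ.deriv_eq_zero_of_nonpos (t := 2 * t - 1) (by linarith), mul_zero, mul_zero, add_zero,
        mul_comm]
    · rw [a.at_cat_of_ge hτ b ⟨h, ht.2⟩, hb _ (hτ.mem_Icc _), scale_scale, hk, hge h,
        hτ.deriv_eq_zero_of_one_le (t := 2 * t) (by linarith), mul_zero, mul_zero, zero_add,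
        mul_comm]

variable (a : APath L x y)

lemma thinHomotopic_unit_cat : ThinHomotopic L ((APath.unit L x).cat hτ a) a :=
  ((isSegment_unit a unitInterval.zero_mem a.base_zero).cat hτ (isSegment_refl a)).thinHomotopic
    (isSegment_refl a)

lemma thinHomotopic_cat_unit : ThinHomotopic L (a.cat hτ (APath.unit L y)) a :=
  ((isSegment_refl a).cat hτ (isSegment_unit a unitInterval.one_mem a.base_one)).thinHomotopic
    (isSegment_refl a)

lemma thinHomotopic_cat_inverse : ThinHomotopic L (a.cat hτ a.inverse) (APath.unit L x) :=
  ((isSegment_refl a).cat hτ a.isInverse_inverse.isSegment).thinHomotopic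
    (isSegment_unit a unitInterval.zero_mem a.base_zero)

lemma thinHomotopic_inverse_cat : ThinHomotopic L (a.inverse.cat hτ a) (APath.unit L y) :=
  (a.isInverse_inverse.isSegment.cat hτ (isSegment_refl a)).thinHomotopic
    (isSegment_unit a unitInterval.one_mem a.base_one)

variable {a} {b : APath L y z} {c : APath L x z}

lemma IsConcat.thinHomotopic_cat (h : IsConcat a b c) : ThinHomotopic L (a.cat hτ b) c :=
  (h.isSegment_first.cat hτ h.isSegment_second).thinHomotopic (isSegment_refl c)

-- Both composites are reparametrizations of `(f g) h`: cut its first half at the time `r / 2`,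
-- where `τ r = 1 / 2`.
lemma thinHomotopic_cat_assoc (f : APath L v w) (g : APath L w x) (h : APath L x y) :
    ThinHomotopic L ((f.cat hτ g).cat hτ h) (f.cat hτ (g.cat hτ h)) := by
  let k := f.cat hτ g
  have hk : IsConcat (f.cutoff hτ) (g.cutoff hτ) k := isConcat_cat hτ f g
  have hkh : IsConcat (k.cutoff hτ) (h.cutoff hτ) (k.cat hτ h) := isConcat_cat hτ k h
  have heq (x y : M) := thinHomotopic_equivalence L x y
  obtain ⟨r, hr, hτr⟩ : ∃ r ∈ Icc (0 : ℝ) 1, τ r = 1 / 2 :=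
    intermediate_value_Icc zero_le_one hτ.smooth.continuous.continuousOn
      (by rw [hτ.eq_zero 0 le_rfl, hτ.eq_one 1 le_rfl]; norm_num)
  have hmid : (k.cutoff hτ).base ![r] = w := by
    rw [← hk.base_half, ← hτr]
    exact congrArg TotalSpace.proj (isReparam_cutoff hτ k r hr)
  obtain ⟨f', hf'⟩ := exists_isSegment (k.cutoff hτ) unitInterval.zero_mem hr
    (k.cutoff hτ).base_zero hmid
  obtain ⟨g', hg'⟩ := exists_isSegment (k.cutoff hτ) hr unitInterval.one_mem hmid
    (k.cutoff hτ).base_one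
  have hf : ThinHomotopic L f' f := by
    have := hf'.of_cutoff hτ
    rw [hτ.eq_zero 0 le_rfl, hτr] at this
    exact (heq v w).trans (this.thinHomotopic hk.isSegment_first) (thinHomotopic_cutoff hτ f)
  have hg : ThinHomotopic L g' g := by
    have := hg'.of_cutoff hτ
    rw [hτ.eq_one 1 le_rfl, hτr] at this
    exact (heq w x).trans (this.thinHomotopic hk.isSegment_second) (thinHomotopic_cutoff hτ g)
  have hf'q : IsSegment (k.cat hτ h) 0 (r / 2) f' := zero_div (2 : ℝ) ▸ hkh.isSegment_left hf'
  have hsegment : IsSegment (k.cat hτ h) 0 1 (f'.cat hτ (g'.cat hτ (h.cutoff hτ))) :=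
    hf'q.cat hτ ((hkh.isSegment_left hg').cat hτ hkh.isSegment_second)
  exact (heq v y).trans ((isSegment_refl _).thinHomotopic hsegment)
    (hf.cat hτ (hg.cat hτ (thinHomotopic_cutoff hτ h)))

end Cat

end Segments

section Groupoids

section Transport

variable {M : Type*} {Hom Hom' : M → M → Type*} (S : GroupoidOver Hom')
  (φ : ∀ x y, Hom x y ≃ Hom' x y)

/-- The groupoid structure transported along bijections of the sets of arrows. -/
def GroupoidOver.transport : GroupoidOver Hom where
  one x := (φ x x).symm (S.one x)
  comp g f := (φ _ _).symm (S.comp (φ _ _ g) (φ _ _ f))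
  inv f := (φ _ _).symm (S.inv (φ _ _ f))
  assoc h g f := by simp only [Equiv.apply_symm_apply, S.assoc]
  one_comp f := by simp only [Equiv.apply_symm_apply, S.one_comp, Equiv.symm_apply_apply]
  comp_one f := by simp only [Equiv.apply_symm_apply, S.comp_one, Equiv.symm_apply_apply]
  inv_comp f := by simp only [Equiv.apply_symm_apply, S.inv_comp]
  comp_inv f := by simp only [Equiv.apply_symm_apply, S.comp_inv]

lemma GroupoidOver.isMorphism_transport : (S.transport φ).IsMorphism S (fun x y => φ x y) where
  map_one _ := Equiv.apply_symm_apply _ _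
  map_comp _ _ := Equiv.apply_symm_apply _ _
  map_inv _ := Equiv.apply_symm_apply _ _

end Transport

variable {E M F : Type*} {A : M → Type*} [NormedAddCommGroup E] [NormedSpace ℝ E]
  [TopologicalSpace M] [ChartedSpace E M] [IsManifold 𝓘(ℝ, E) ∞ M] [NormedAddCommGroup F]
  [NormedSpace ℝ F] [TopologicalSpace (TotalSpace F A)] [∀ x, AddCommGroup (A x)]
  [∀ x, Module ℝ (A x)] [∀ x, TopologicalSpace (A x)] [FiberBundle F A] [VectorBundle ℝ F A]
  [ContMDiffVectorBundle ∞ F A 𝓘(ℝ, E)] [FiniteDimensional ℝ E] [FiniteDimensional ℝ F]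
  [T2Space M] {L : LieAlgebroid E M F A}

/-- A relation on `A`-paths with fixed ends, coarser than thin homotopy, whose classes inherit the
groupoid structure given by concatenation. -/
structure IsPathCongruence (R : ∀ x y : M, APath L x y → APath L x y → Prop) : Prop where
  equivalence : ∀ x y, Equivalence (R x y)
  of_thinHomotopic : ∀ {x y} {a b : APath L x y}, ThinHomotopic L a b → R x y a b
  cat : ∀ {τ} (hτ : IsCutoff τ) {x y z} {a a' : APath L x y} {b b' : APath L y z},
    R x y a a' → R y z b b' → R x z (a.cat hτ b) (a'.cat hτ b')
  inverse : ∀ {x y} {a b : APath L x y}, R x y a b → R y x a.inverse b.inverse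

lemma isPathCongruence_thinHomotopic : IsPathCongruence fun _ _ : M => ThinHomotopic L where
  equivalence := fun _ _ => thinHomotopic_equivalence L _ _
  of_thinHomotopic := _root_.id
  cat hτ _ _ _ _ _ _ _ := ThinHomotopic.cat hτ
  inverse := ThinHomotopic.inverse

lemma isPathCongruence_aHomotopic : IsPathCongruence fun _ _ : M => AHomotopic L where
  equivalence := fun _ _ => aHomotopic_equivalence L _ _
  of_thinHomotopic := ThinHomotopic.aHomotopic
  cat hτ _ _ _ _ _ _ _ := AHomotopic.cat hτ
  inverse := AHomotopic.inverse

namespace IsPathCongruence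

variable {R : ∀ x y : M, APath L x y → APath L x y → Prop} (hR : IsPathCongruence R)

/-- The groupoid of classes of `A`-paths. -/
def groupoid : GroupoidOver fun x y => Quot (R x y) where
  one x := Quot.mk _ (.unit L x)
  comp := Quot.map₂ (fun b a => a.cat isCutoff_smoothTransition b)
    (fun b _ _ h => hR.cat _ h ((hR.equivalence _ _).refl b))
    fun _ _ a h => hR.cat _ ((hR.equivalence _ _).refl a) h
  inv := Quot.map APath.inverse fun _ _ => hR.inverse
  assoc := by
    rintro w x y z ⟨h⟩ ⟨g⟩ ⟨f⟩
    exact (Quot.sound (hR.of_thinHomotopic (thinHomotopic_cat_assoc _ f g h))).symm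
  one_comp := by
    rintro x y ⟨a⟩
    exact Quot.sound (hR.of_thinHomotopic (thinHomotopic_cat_unit _ a))
  comp_one := by
    rintro x y ⟨a⟩
    exact Quot.sound (hR.of_thinHomotopic (thinHomotopic_unit_cat _ a))
  inv_comp := by
    rintro x y ⟨a⟩
    exact Quot.sound (hR.of_thinHomotopic (thinHomotopic_cat_inverse _ a))
  comp_inv := by
    rintro x y ⟨a⟩
    exact Quot.sound (hR.of_thinHomotopic (thinHomotopic_inverse_cat _ a))

lemma groupoid_comp_mk_mk {x y z : M} {a : APath L x y} {b : APath L y z} {c : APath L x z}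
    (h : IsConcat a b c) : hR.groupoid.comp (Quot.mk _ b) (Quot.mk _ a) = Quot.mk _ c :=
  Quot.sound (hR.of_thinHomotopic (h.thinHomotopic_cat _))

lemma isConcatenationStructure_groupoid :
    IsConcatenationStructure hR.groupoid fun x y a => Quot.mk (R x y) a where
  one_eq x := ⟨.unit L x, isUnitPath_unit, rfl⟩
  inv_eq a := ⟨a.inverse, a.isInverse_inverse, rfl⟩
  comp_eq _ _ _ h := hR.groupoid_comp_mk_mk h
  comp_reparam τ hτ {x y z} a b := by
    have hcutoff {x y : M} (a : APath L x y) :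
        Quot.mk (R x y) (a.cutoff hτ) = Quot.mk (R x y) a :=
      Quot.sound (hR.of_thinHomotopic (thinHomotopic_cutoff hτ a))
    refine ⟨_, _, _, isReparam_cutoff hτ a, isReparam_cutoff hτ b, isConcat_cat hτ a b, ?_⟩
    rw [← hR.groupoid_comp_mk_mk (isConcat_cat hτ a b), hcutoff, hcutoff]

end IsPathCongruence

lemma related_mk_iff {x y : M} {a b : APath L x y} :
    P₂.Related L (P₁.mk a) (P₁.mk b) ↔ AHomotopic L a b := by
  have heq := aHomotopic_equivalence L x y
  refine ⟨?_, fun ⟨σ⟩ => ⟨Quot.mk _ ⟨a, b, σ⟩, rfl, rfl⟩⟩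
  rintro ⟨⟨⟨a', b', σ⟩⟩, ha, hb⟩
  have ha' : ThinHomotopic L a' a := ((thinHomotopic_equivalence L x y).quot_mk_eq_iff _ _).1 ha
  have hb' : ThinHomotopic L b' b := ((thinHomotopic_equivalence L x y).quot_mk_eq_iff _ _).1 hb
  exact heq.trans (heq.symm ha'.aHomotopic) (heq.trans ⟨σ⟩ hb'.aHomotopic)

variable (L)

lemma related_equivalence (x y : M) : Equivalence (P₂.Related L (x := x) (y := y)) where
  refl := by
    rintro ⟨a⟩
    exact related_mk_iff.2 ((aHomotopic_equivalence L x y).refl a)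
  symm := by
    rintro ⟨a⟩ ⟨b⟩ h
    exact related_mk_iff.2 ((aHomotopic_equivalence L x y).symm (related_mk_iff.1 h))
  trans := by
    rintro ⟨a⟩ ⟨b⟩ ⟨c⟩ h h'
    exact related_mk_iff.2
      ((aHomotopic_equivalence L x y).trans (related_mk_iff.1 h) (related_mk_iff.1 h'))

/-- The bijection `[[a]] ↦ [a]` from the arrows of the 1-truncation of the Weinstein 2-groupoid to
those of the Weinstein groupoid. -/
def truncationEquiv (x y : M) : Truncation L x y ≃ G L x y where
  toFun := Quot.lift (Quot.lift G.mk fun _ _ h => Quot.sound h.aHomotopic) <| by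
    rintro ⟨a⟩ ⟨b⟩ h
    exact Quot.sound (related_mk_iff.1 h)
  invFun := Quot.lift (fun a => Truncation.mk (P₁.mk a)) fun _ _ h =>
    Quot.sound (related_mk_iff.2 h)
  left_inv := by
    rintro ⟨⟨a⟩⟩
    rfl
  right_inv := by
    rintro ⟨a⟩
    rfl

/-- The groupoid of thin homotopy classes of `A`-paths. -/
def groupoidP₁ : GroupoidOver (P₁ L) := isPathCongruence_thinHomotopic.groupoid

/-- The Weinstein groupoid. -/
def weinsteinGroupoid : GroupoidOver (G L) := isPathCongruence_aHomotopic.groupoid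

/-- The groupoid structure of the 1-truncation. Its definition by transport is justified by
`isMorphism_truncationMk`. -/
def truncationGroupoid : GroupoidOver (Truncation L) :=
  (weinsteinGroupoid L).transport (truncationEquiv L)

lemma isMorphism_truncationMk :
    (groupoidP₁ L).IsMorphism (truncationGroupoid L) fun _ _ => Truncation.mk where
  map_one _ := rfl
  map_comp := by
    rintro x y z ⟨b⟩ ⟨a⟩
    rfl
  map_inv := by
    rintro x y ⟨a⟩
    rfl

end Groupoids

end Weinstein

end

theorem proposition4
    {E : Type*} [NormedAddCommGroup E] [NormedSpace ℝ E] [FiniteDimensional ℝ E]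
    {M : Type*} [TopologicalSpace M] [T2Space M] [ChartedSpace E M] [IsManifold 𝓘(ℝ, E) ∞ M]
    {F : Type*} [NormedAddCommGroup F] [NormedSpace ℝ F] [FiniteDimensional ℝ F]
    {A : M → Type*} [TopologicalSpace (TotalSpace F A)]
    [∀ x, AddCommGroup (A x)] [∀ x, Module ℝ (A x)] [∀ x, TopologicalSpace (A x)]
    [FiberBundle F A] [VectorBundle ℝ F A] [ContMDiffVectorBundle ∞ F A 𝓘(ℝ, E)]
    (L : Weinstein.LieAlgebroid E M F A) :
    (∀ x y : M,
      Equivalence (Weinstein.ThinHomotopic L (x := x) (y := y)) ∧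
      Equivalence (Weinstein.AHomotopic L (x := x) (y := y)) ∧
      Equivalence (Weinstein.ThreeHomotopic L (x := x) (y := y)) ∧
      Equivalence (Weinstein.P₂.Related L (x := x) (y := y))) ∧
    ∃ (S : Weinstein.GroupoidOver (Weinstein.P₁ L))
      (T : Weinstein.GroupoidOver (Weinstein.Truncation L))
      (W : Weinstein.GroupoidOver (Weinstein.G L)),
      Weinstein.IsConcatenationStructure S (fun _ _ a => Weinstein.P₁.mk a) ∧
      S.IsMorphism T (fun _ _ α => Weinstein.Truncation.mk α) ∧
      Weinstein.IsConcatenationStructure W (fun _ _ a => Weinstein.G.mk a) ∧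
      ∃ Φ : ∀ x y, Weinstein.Truncation L x y ≃ Weinstein.G L x y,
        T.IsMorphism W (fun x y => Φ x y) ∧
        ∀ (x y : M) (a : Weinstein.APath L x y),
          Φ x y (Weinstein.Truncation.mk (Weinstein.P₁.mk a)) = Weinstein.G.mk a := by
  exact ⟨fun x y => ⟨Weinstein.thinHomotopic_equivalence L x y,
      Weinstein.aHomotopic_equivalence L x y, Weinstein.threeHomotopic_equivalence L x y,
      Weinstein.related_equivalence L x y⟩,
    Weinstein.groupoidP₁ L, Weinstein.truncationGroupoid L, Weinstein.weinsteinGroupoid L,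
    Weinstein.isPathCongruence_thinHomotopic.isConcatenationStructure_groupoid,
    Weinstein.isMorphism_truncationMk L,
    Weinstein.isPathCongruence_aHomotopic.isConcatenationStructure_groupoid,
    Weinstein.truncationEquiv L, Weinstein.GroupoidOver.isMorphism_transport _ _,
    fun _ _ _ => rfl⟩
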